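/- A Motzkin path of length $n$ is a lattice path from $(0,0)$ to $(n,0)$ with steps $U=(1,1)$, $D=(1,-1)$, $L=(1,0)$ that never passes below the $x$-axis; $\mathbf M_n$ is the set of these paths. The descent set $\mathrm{Des}(M)$ of $M\in\mathbf M_n$ is the set of all $i\in\{1,\dots,n-1\}$ such that the $i$th and $(i+1)$st steps of $M$ are, in this order, $UD$, $UL$ or $DL$. A standard Young tableau (SYT) of skew shape $\lambda/\mu$ with $n$ cells is a filling of the cells of $\lambda/\mu$ with $1,\dots,n$, each used once, increasing from left to right in rows and from top to bottom in columns; its shape is straight if $\mu=\varnothing$. The descent set $\mathrm{Des}(T)$ of such a tableau $T$ is the set of all $i\in\{1,\dots,n-1\}$ such that $i+1$ lies in a lower row of $T$ than $i$. For $M\in\mathbf M_n$ with $k$ steps $U$, let $\Gamma(M)$ be the SYT of skew shape $(n-k,n-k,n-2k)/(n-2k,n-2k)$ whose first, second and third row consist of those $i\in\{1,\dots,n\}$ for which the $i$th step of $M$ is $U$, $D$ and $L$, respectively. For a skew SYT $T$, let $\mathrm{jdt}(T)$ be the SYT of straight shape obtained from $T$ by successive inward jeu de taquin slides. **Proposition.**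 Let $n\ge 0$. For every $M\in\mathbf M_n$, jeu de taquin slides transform $\Gamma(M)$ into exactly one SYT $\mathrm{jdt}(\Gamma(M))$ of straight shape, whatever the choice of slides. The map $\tilde\Gamma=\mathrm{jdt}\circ\Gamma$ is a bijection from $\mathbf M_n$ to the set of SYT of straight shape of size $n$ with at most $3$ rows, and $$\mathrm{Des}(M)=\mathrm{Des}(\tilde\Gamma(M))\qquad\text{for all } M\in\mathbf M_n .$$ -/

import Mathlib

/-! ### Motzkin paths -/

/-- The three kinds of steps of a Motzkin path: up `(1, 1)`, down `(1, -1)`, level `(1, 0)`. -/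
inductive MotzkinStep
  | U | D | L
  deriving DecidableEq

/-- The vertical displacement of a step. -/
def MotzkinStep.rise : MotzkinStep → ℤ
  | U => 1
  | D => -1
  | L => 0

/-- A Motzkin path of length `n`: a sequence of `n` steps starting at height `0`, ending at height
`0`, and never passing below height `0`. -/
@[ext]
structure MotzkinPath (n : ℕ) where
  steps : List MotzkinStep
  length_eq : steps.length = n
  height_nonneg : ∀ i, 0 ≤ ((steps.take i).map MotzkinStep.rise).sum
  height_end : (steps.map MotzkinStep.rise).sum = 0

/-- The descent set of a Motzkin path. Steps are numbered `1, …, n`, so that the `i`th step is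
`steps[i - 1]`; the step `i` is a descent when the steps `i`, `i + 1` are `UD`, `UL` or `DL`. -/
def MotzkinPath.descents {n : ℕ} (M : MotzkinPath n) : Set ℕ :=
  {i | 1 ≤ i ∧
    ((M.steps[i - 1]? = some .U ∧ M.steps[i]? = some .D) ∨
     (M.steps[i - 1]? = some .U ∧ M.steps[i]? = some .L) ∨
     (M.steps[i - 1]? = some .D ∧ M.steps[i]? = some .L))}

/-! ### Standard Young tableaux of skew shape -/

/-- A standard Young tableau with `n` cells of skew shape `outer / inner`. A cell is a pair
`(row, column)`, both numbered from `0`, rows downwards and columns rightwards. By convention the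
filling is `0` off the skew shape, so that a tableau is determined by its shape and its entries. -/
@[ext]
structure SkewSYT (n : ℕ) where
  inner : YoungDiagram
  outer : YoungDiagram
  inner_le : inner ≤ outer
  entry : ℕ × ℕ → ℕ
  entry_zero : ∀ c, c ∉ outer.cells \ inner.cells → entry c = 0
  entry_bijOn : Set.BijOn entry (outer.cells \ inner.cells : Finset (ℕ × ℕ)) (Set.Icc 1 n)
  row_strict : ∀ i j₁ j₂, j₁ < j₂ → (i, j₁) ∈ outer.cells \ inner.cells →
    (i, j₂) ∈ outer.cells \ inner.cells → entry (i, j₁) < entry (i, j₂)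
  col_strict : ∀ i₁ i₂ j, i₁ < i₂ → (i₁, j) ∈ outer.cells \ inner.cells →
    (i₂, j) ∈ outer.cells \ inner.cells → entry (i₁, j) < entry (i₂, j)

namespace SkewSYT

/-- The cells of the skew shape of `T`. -/
def cells {n : ℕ} (T : SkewSYT n) : Finset (ℕ × ℕ) := T.outer.cells \ T.inner.cells

/-- The descent set of `T`: all `i ∈ [n - 1]` such that `i + 1` is in a lower row than `i`. -/
def descents {n : ℕ} (T : SkewSYT n) : Set ℕ :=
  {i | ∃ c ∈ T.cells, ∃ d ∈ T.cells, T.entry c = i ∧ T.entry d = i + 1 ∧ c.1 < d.1}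

/-- `T` has straight shape. -/
def IsStraight {n : ℕ} (T : SkewSYT n) : Prop := T.inner = ⊥

/-! ### Jeu de taquin -/

/-- One move of the empty cell `h` (the hole) in a filling `f` of a diagram with outer shape `lam`:
of the neighbours of the hole to the right and below that lie in `lam`, the one with the smaller
entry is moved into the hole, and its former cell becomes the hole. -/
inductive HoleMove (lam : YoungDiagram) :
    (ℕ × ℕ → ℕ) × (ℕ × ℕ) → (ℕ × ℕ → ℕ) × (ℕ × ℕ) → Prop
  | right (f : ℕ × ℕ → ℕ) (i j : ℕ) (hmem : (i, j + 1) ∈ lam)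
      (hlt : (i + 1, j) ∈ lam → f (i, j + 1) < f (i + 1, j)) :
      HoleMove lam (f, (i, j))
        (Function.update (Function.update f (i, j) (f (i, j + 1))) (i, j + 1) 0, (i, j + 1))
  | down (f : ℕ × ℕ → ℕ) (i j : ℕ) (hmem : (i + 1, j) ∈ lam)
      (hlt : (i, j + 1) ∈ lam → f (i + 1, j) < f (i, j + 1)) :
      HoleMove lam (f, (i, j))
        (Function.update (Function.update f (i, j) (f (i + 1, j))) (i + 1, j) 0, (i + 1, j))

/-- `c` is a corner of the Young diagram `mu`: a cell with no cell of `mu` to its right or below. -/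
def IsCorner (mu : YoungDiagram) (c : ℕ × ℕ) : Prop :=
  c ∈ mu ∧ (c.1, c.2 + 1) ∉ mu ∧ (c.1 + 1, c.2) ∉ mu

/-- `T'` arises from `T` by one (inward) jeu de taquin slide: the hole starts at a corner `c` of the
inner shape and moves until it reaches a corner `h` of the outer shape; `c` is then removed from
the inner shape and `h` from the outer shape. -/
def Slide {n : ℕ} (T T' : SkewSYT n) : Prop :=
  ∃ c h : ℕ × ℕ, IsCorner T.inner c ∧
    Relation.ReflTransGen (HoleMove T.outer) (T.entry, c) (T'.entry, h) ∧
    IsCorner T.outer h ∧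
    T'.inner.cells = T.inner.cells.erase c ∧ T'.outer.cells = T.outer.cells.erase h

/-- `S` is a jeu de taquin rectification of `T`: a tableau of straight shape that is obtained from
`T` by some sequence of slides. -/
def IsRectification {n : ℕ} (T S : SkewSYT n) : Prop :=
  Relation.ReflTransGen Slide T S ∧ S.IsStraight

end SkewSYT

/-- The standard Young tableaux of straight shape, of size `n`, with at most `r` rows. -/
def StraightSYT (n r : ℕ) : Type :=
  {T : SkewSYT n // T.IsStraight ∧ T.outer.colLen 0 ≤ r}

/-! ### The map `Γ` from Motzkin paths to skew tableaux -/

namespace MotzkinPath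

/-- The step `i` (numbered from `0`) of the path is of kind `s`. -/
abbrev IsStep {n : ℕ} (M : MotzkinPath n) (s : MotzkinStep) (i : ℕ) : Prop := M.steps[i]? = some s

/-- The number of up steps. -/
def numU {n : ℕ} (M : MotzkinPath n) : ℕ := M.steps.count .U

/-- The kind of steps that are recorded in a row: `U`, `D`, `L` in the first, second, third row. -/
def stepOfRow : ℕ → MotzkinStep
  | 0 => .U
  | 1 => .D
  | _ => .L

/-- The inner shape `(n - 2k, n - 2k)`, where `k` is the number of up steps. -/
def gammaInner {n : ℕ} (M : MotzkinPath n) : YoungDiagram :=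
  YoungDiagram.ofRowLens [n - 2 * M.numU, n - 2 * M.numU] (by simp [List.sortedGE_iff_pairwise])

/-- The outer shape `(n - k, n - k, n - 2k)`, where `k` is the number of up steps. -/
def gammaOuter {n : ℕ} (M : MotzkinPath n) : YoungDiagram :=
  YoungDiagram.ofRowLens [n - M.numU, n - M.numU, n - 2 * M.numU] (by
    have h : n - 2 * M.numU ≤ n - M.numU := by omega
    simpa [List.sortedGE_iff_pairwise] using h)

/-- The filling of the skew shape: the `i`th step (numbered from `1`) puts the entry `i` into the
first, second or third row according as it is `U`, `D` or `L`. Each row is filled from left to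
right, so its `m`th cell holds the position of the `m`th step of the corresponding kind. -/
noncomputable def gammaEntry {n : ℕ} (M : MotzkinPath n) (c : ℕ × ℕ) : ℕ :=
  if c ∈ M.gammaOuter.cells \ M.gammaInner.cells then
    Nat.nth (M.IsStep (stepOfRow c.1)) (c.2 - if c.1 < 2 then n - 2 * M.numU else 0) + 1
  else 0

theorem sum_rise (l : List MotzkinStep) :
    (l.map MotzkinStep.rise).sum = (l.count .U : ℤ) - l.count .D := by
  induction l with
  | nil => simp
  | cons a l ih =>
    rw [List.map_cons, List.sum_cons, ih]
    cases a <;> simp [MotzkinStep.rise] <;> ring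

theorem count_take (l : List MotzkinStep) (s : MotzkinStep) (i : ℕ) :
    (l.take i).count s = Nat.count (fun j => l[j]? = some s) i := by
  induction i with
  | zero => simp
  | succ i ih =>
    rw [List.take_add_one, List.count_append, ih, Nat.count_succ]
    rcases h : l[i]? with _ | t
    · simp
    · by_cases hts : t = s <;> simp [hts]

theorem count_total (l : List MotzkinStep) :
    l.count .U + l.count .D + l.count .L = l.length := by
  induction l with
  | nil => simp
  | cons a l ih => cases a <;> simp <;> omega

theorem count_isStep {n : ℕ} (M : MotzkinPath n) (s : MotzkinStep) :
    Nat.count (M.IsStep s) n = M.steps.count s := by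
  have h := count_take M.steps s n
  rw [List.take_of_length_le (by rw [M.length_eq])] at h
  exact h.symm

theorem count_D {n : ℕ} (M : MotzkinPath n) : M.steps.count .D = M.numU := by
  have h := M.height_end
  rw [sum_rise] at h
  unfold numU
  omega

theorem count_L {n : ℕ} (M : MotzkinPath n) : M.steps.count .L + 2 * M.numU = n := by
  have h := count_total M.steps
  rw [count_D, M.length_eq] at h
  unfold numU at *
  omega

theorem count_D_le {n : ℕ} (M : MotzkinPath n) (i : ℕ) :
    Nat.count (M.IsStep .D) i ≤ Nat.count (M.IsStep .U) i := by
  have h := M.height_nonneg i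
  rw [sum_rise, count_take, count_take] at h
  have h' : (Nat.count (M.IsStep .D) i : ℤ) ≤ Nat.count (M.IsStep .U) i := by
    simpa using h
  exact_mod_cast h'

theorem mem_gammaInner {n : ℕ} (M : MotzkinPath n) (i j : ℕ) :
    (i, j) ∈ M.gammaInner ↔ i < 2 ∧ j < n - 2 * M.numU := by
  unfold gammaInner
  rw [YoungDiagram.mem_ofRowLens]
  match i with
  | 0 => simp
  | 1 => simp
  | i + 2 => simp

theorem mem_gammaOuter {n : ℕ} (M : MotzkinPath n) (i j : ℕ) :
    (i, j) ∈ M.gammaOuter ↔ (i < 2 ∧ j < n - M.numU) ∨ (i = 2 ∧ j < n - 2 * M.numU) := by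
  unfold gammaOuter
  rw [YoungDiagram.mem_ofRowLens]
  match i with
  | 0 => simp
  | 1 => simp
  | 2 => simp
  | i + 3 => simp

/-- The cells of the skew shape `(n - k, n - k, n - 2k) / (n - 2k, n - 2k)`, with offsets. -/
theorem mem_gammaCells {n : ℕ} (M : MotzkinPath n) (i j : ℕ) :
    (i, j) ∈ M.gammaOuter.cells \ M.gammaInner.cells ↔
      i < 3 ∧ (if i < 2 then n - 2 * M.numU else 0) ≤ j ∧
        j - (if i < 2 then n - 2 * M.numU else 0) < Nat.count (M.IsStep (stepOfRow i)) n := by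
  have hL := M.count_L
  rw [Finset.mem_sdiff, YoungDiagram.mem_cells, YoungDiagram.mem_cells, mem_gammaInner,
    mem_gammaOuter, count_isStep]
  match i with
  | 0 => simp only [stepOfRow]; rw [← numU]; simp; omega
  | 1 => simp only [stepOfRow]; rw [count_D]; simp; omega
  | 2 => simp only [stepOfRow]; simp; omega
  | i + 3 => simp

theorem lt_card_of_lt_count {p : ℕ → Prop} [DecidablePred p] {m n : ℕ} (h : m < Nat.count p n) :
    ∀ hf : (Set.ofPred p).Finite, m < hf.toFinset.card := by
  intro hf
  refine lt_of_lt_of_le h ?_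
  rw [Nat.count_eq_card_filter_range]
  exact Finset.card_le_card fun x hx => by simpa using (Finset.mem_filter.1 hx).2

/-- The map `Γ`. -/
noncomputable def gamma {n : ℕ} (M : MotzkinPath n) : SkewSYT n where
  inner := M.gammaInner
  outer := M.gammaOuter
  inner_le := by
    rintro ⟨i, j⟩ h
    rw [mem_gammaInner] at h
    rw [mem_gammaOuter]
    omega
  entry := M.gammaEntry
  entry_zero c hc := if_neg hc
  entry_bijOn := by
    refine ⟨?_, ?_, ?_⟩
    · rintro ⟨i, j⟩ hc
      rw [Finset.mem_coe] at hc
      rw [gammaEntry, if_pos hc]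
      have h := Nat.nth_lt_of_lt_count ((M.mem_gammaCells i j).1 hc).2.2
      simp only [Set.mem_Icc]
      omega
    · rintro ⟨i, j⟩ hc ⟨i', j'⟩ hc' heq
      rw [Finset.mem_coe] at hc hc'
      rw [gammaEntry, if_pos hc, gammaEntry, if_pos hc', Nat.add_right_cancel_iff] at heq
      obtain ⟨hi, hj, hlt⟩ := (M.mem_gammaCells i j).1 hc
      obtain ⟨hi', hj', hlt'⟩ := (M.mem_gammaCells i' j').1 hc'
      have h1 := Nat.nth_mem _ (lt_card_of_lt_count hlt)
      have h1' := Nat.nth_mem _ (lt_card_of_lt_count hlt')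
      have h2 := Nat.count_nth (lt_card_of_lt_count hlt)
      have h2' := Nat.count_nth (lt_card_of_lt_count hlt')
      simp only at heq
      rw [heq] at h1 h2
      have hs : stepOfRow i = stepOfRow i' := Option.some.inj (h1.symm.trans h1')
      have hii : i = i' := by
        interval_cases i <;> interval_cases i' <;> simp_all [stepOfRow]
      subst hii
      rw [h2] at h2'
      have : j = j' := by omega
      rw [this]
    · intro v hv
      simp only [Set.mem_Icc] at hv
      have hlen : v - 1 < M.steps.length := by rw [M.length_eq]; omega
      obtain ⟨i, hi, hs⟩ : ∃ i, i < 3 ∧ M.IsStep (stepOfRow i) (v - 1) := by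
        unfold IsStep
        rw [List.getElem?_eq_getElem hlen]
        rcases M.steps[v - 1] with _ | _ | _
        · exact ⟨0, by norm_num, rfl⟩
        · exact ⟨1, by norm_num, rfl⟩
        · exact ⟨2, by norm_num, rfl⟩
      have hc : (i, (if i < 2 then n - 2 * M.numU else 0) +
          Nat.count (M.IsStep (stepOfRow i)) (v - 1)) ∈
            M.gammaOuter.cells \ M.gammaInner.cells := by
        rw [mem_gammaCells]
        refine ⟨hi, Nat.le_add_right _ _, ?_⟩
        rw [Nat.add_sub_cancel_left]
        exact Nat.count_strict_mono hs (by omega)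
      refine ⟨_, Finset.mem_coe.2 hc, ?_⟩
      rw [gammaEntry, if_pos hc]
      simp only
      rw [Nat.add_sub_cancel_left, Nat.nth_count hs]
      omega
  row_strict := by
    intro i j₁ j₂ hj h₁ h₂
    rw [gammaEntry, if_pos h₁, gammaEntry, if_pos h₂]
    obtain ⟨-, hj₁, -⟩ := (M.mem_gammaCells i j₁).1 h₁
    obtain ⟨-, hj₂, hlt⟩ := (M.mem_gammaCells i j₂).1 h₂
    have h := Nat.nth_lt_nth' (p := M.IsStep (stepOfRow i))
      (m := j₁ - if i < 2 then n - 2 * M.numU else 0) (by omega) (lt_card_of_lt_count hlt)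
    simp only
    omega
  col_strict := by
    intro i₁ i₂ j hi h₁ h₂
    rw [gammaEntry, if_pos h₁, gammaEntry, if_pos h₂]
    obtain ⟨h3₁, hj₁, -⟩ := (M.mem_gammaCells i₁ j).1 h₁
    obtain ⟨h3₂, hj₂, hlt⟩ := (M.mem_gammaCells i₂ j).1 h₂
    have hL := M.count_L
    obtain ⟨rfl, rfl⟩ : i₁ = 0 ∧ i₂ = 1 := by
      by_contra hne
      have hi₂ : i₂ = 2 := by omega
      subst hi₂
      rw [count_isStep] at hlt
      have hi₁ : i₁ < 2 := hi
      simp only [hi₁, if_true] at hj₁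
      simp [stepOfRow] at hlt
      omega
    simp only [Nat.zero_lt_two, Nat.one_lt_two, if_true, stepOfRow] at hlt ⊢
    set m := j - (n - 2 * M.numU)
    have hD := Nat.count_nth_succ (lt_card_of_lt_count hlt)
    have hU := M.count_D_le (Nat.nth (M.IsStep .D) m + 1)
    rw [hD] at hU
    have hlt' : Nat.nth (M.IsStep .U) m < Nat.nth (M.IsStep .D) m + 1 :=
      Nat.nth_lt_of_lt_count (by omega)
    have hmU := Nat.nth_mem _ (lt_card_of_lt_count (p := M.IsStep .U) (m := m)
      (n := Nat.nth (M.IsStep .D) m + 1) (by omega))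
    have hmD := Nat.nth_mem _ (lt_card_of_lt_count hlt)
    have hne : Nat.nth (M.IsStep .U) m ≠ Nat.nth (M.IsStep .D) m := by
      intro h
      rw [h] at hmU
      exact absurd (Option.some.inj (hmU.symm.trans hmD)) (by decide)
    omega

end MotzkinPath

/-!
A skew tableau is encoded by its inner shape `mu` and its row word `l`, whose letter number `v` is
the row (counted from `0`) of the entry `v + 1`. The tableau `Γ(M)` has the row word obtained from
`M` by `U, D, L ↦ 0, 1, 2`, and a straight tableau is the same thing as a dominant word.

A slide that starts in row `r` moves an entry from row `r + 1` to row `r` exactly when the word is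
not compatible with the shortened inner shape, and then the entry moved is the letter changed by the
crystal raising operator `e_r` (`RowWord.RaiseAt`): the letter at which the prefix surplus
`#(r + 1) - #r` first attains its maximum (`RowWord.slidesTo_of_isLattice`,
`RowWord.slidesTo_of_raiseAt`). So rectification applies raising operators until the word is
dominant, and raising operators preserve descents (`RowWord.RaiseAt.descents_eq`).

On arbitrary words in three letters the operators `e_0` and `e_1` do not commute, but they do on
*tame* words: those for which `(#2 - #1)(t) + (#1 - #0)(s)`, over prefixes of lengths `s ≤ t`, never
exceeds the maximum of `#2 - #1` (`RowWord.Raise.commute`). Words of Motzkin paths are tame, since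
there `#1 - #0` is never positive, and tameness is preserved by raising. Tameness also implies that
a hole starting in the first row never reaches the third one. Hence, by the Church–Rosser property,
all sequences of slides lead to the same dominant word (`RowWord.IsDominant.unique`).

For bijectivity, the dominant word of a Motzkin word is reached by applying `e_1` as long as
possible and then `e_0` as long as possible (`RowWord.IsMotzkin.exists_steps`). Each operator is
injective, and the words at which the two phases begin are recognized by their surplus
`#1 - #0`, so the path can be recovered (`RowWord.IsMotzkin.injective`). Conversely, both phases can
be undone from any dominant word; tameness, inherited backwards, guarantees that the inverse of
`e_1` is defined as long as it is needed (`RowWord.IsDominant.exists_isMotzkin`).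
-/

/-! ### Words and raising operators -/

namespace RowWord

/-- The number of letters `i` among the first `t` letters of the word `l`. -/
def rowCount (l : List ℕ) (i t : ℕ) : ℕ := (l.take t).count i

/-- The surplus of letters `r + 1` over letters `r` among the first `t` letters. -/
def excess (l : List ℕ) (r t : ℕ) : ℤ := rowCount l (r + 1) t - rowCount l r t

@[simp] theorem rowCount_zero (l : List ℕ) (i : ℕ) : rowCount l i 0 = 0 := by simp [rowCount]

@[simp] theorem excess_zero (l : List ℕ) (r : ℕ) : excess l r 0 = 0 := by simp [excess]

theorem rowCount_succ {l : List ℕ} {t x : ℕ} (h : l[t]? = some x) (i : ℕ) :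
    rowCount l i (t + 1) = rowCount l i t + if x = i then 1 else 0 := by
  rw [rowCount, rowCount, List.take_add_one, List.count_append, h]
  by_cases hx : x = i <;> simp [hx]

theorem rowCount_of_length_le {l : List ℕ} {t : ℕ} (h : l.length ≤ t) (i : ℕ) :
    rowCount l i t = rowCount l i l.length := by
  simp [rowCount, List.take_of_length_le h]

theorem rowCount_mono (l : List ℕ) (i : ℕ) {s t : ℕ} (h : s ≤ t) :
    rowCount l i s ≤ rowCount l i t :=
  (List.take_sublist_take_left h).count_le i

theorem lt_length {l : List ℕ} {t x : ℕ} (h : l[t]? = some x) : t < l.length := by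
  by_contra hlt
  rw [List.getElem?_eq_none (by omega)] at h
  cases h

theorem rowCount_set {l : List ℕ} {t x : ℕ} (h : l[t]? = some x) (y i s : ℕ) :
    rowCount (l.set t y) i s + (if t < s ∧ x = i then 1 else 0) =
      rowCount l i s + (if t < s ∧ y = i then 1 else 0) := by
  have hl := lt_length h
  induction s with
  | zero => simp
  | succ s ih =>
    rcases hs : l[s]? with _ | z
    · have hs' : l.length ≤ s := by simpa using hs
      rw [rowCount_of_length_le (by simp; omega)] at ih ⊢
      rw [rowCount_of_length_le (l := l) (by omega)] at ih ⊢
      have h1 : t < s := by omega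
      have h2 : t < s + 1 := by omega
      simpa [h1, h2] using ih
    · rw [rowCount_succ hs]
      by_cases hts : t = s
      · subst hts
        have hz : z = x := by rw [hs] at h; exact Option.some.inj h
        subst hz
        rw [rowCount_succ (x := y) (by simp [hl])]
        simp at ih ⊢
        omega
      · rw [rowCount_succ (x := z) (by simpa [List.getElem?_set, hts] using hs)]
        have h3 : t < s + 1 ↔ t < s := by omega
        simp only [h3]
        omega

theorem excess_succ_le (l : List ℕ) (r t : ℕ) : excess l r (t + 1) ≤ excess l r t + 1 := by
  unfold excess
  rcases h : l[t]? with _ | x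
  · have h' : l.length ≤ t := by simpa using h
    simp only [rowCount_of_length_le (t := t + 1) (by omega : l.length ≤ t + 1),
      rowCount_of_length_le h']
    omega
  · rw [rowCount_succ h, rowCount_succ h]
    split_ifs <;> omega

theorem excess_of_length_le {l : List ℕ} {t : ℕ} (h : l.length ≤ t) (r : ℕ) :
    excess l r t = excess l r l.length := by
  unfold excess
  rw [rowCount_of_length_le h, rowCount_of_length_le h]

/-- A strict increase of the surplus comes from a letter `r + 1`. -/
theorem getElem?_of_excess_lt {l : List ℕ} {r t : ℕ} (h : excess l r t < excess l r (t + 1)) :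
    l[t]? = some (r + 1) := by
  unfold excess at h
  rcases hx : l[t]? with _ | x
  · have h' : l.length ≤ t := by simpa using hx
    simp only [rowCount_of_length_le (t := t + 1) (by omega : l.length ≤ t + 1),
      rowCount_of_length_le h'] at h
    omega
  · rw [rowCount_succ hx, rowCount_succ hx] at h
    have : x = r + 1 := by
      by_contra hne
      simp only [hne, if_false] at h
      split_ifs at h <;> omega
    rw [this]

/-- A strict decrease of the surplus comes from a letter `r`. -/
theorem getElem?_of_lt_excess {l : List ℕ} {r t : ℕ} (h : excess l r (t + 1) < excess l r t) :
    l[t]? = some r := by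
  unfold excess at h
  rcases hx : l[t]? with _ | x
  · have h' : l.length ≤ t := by simpa using hx
    simp only [rowCount_of_length_le (t := t + 1) (by omega : l.length ≤ t + 1),
      rowCount_of_length_le h'] at h
    omega
  · rw [rowCount_succ hx, rowCount_succ hx] at h
    have : x = r := by
      by_contra hne
      simp only [hne, if_false] at h
      split_ifs at h <;> omega
    rw [this]

/-- `l'` arises from `l` by the raising operator of the crystal of words that turns a letter
`r + 1` into `r`: the changed letter, at position `t`, is the one at which the surplus of letters
`r + 1` over letters `r` attains its maximum for the first time. -/
structure RaiseAt (r t : ℕ) (l l' : List ℕ) : Prop where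
  letter : l[t]? = some (r + 1)
  first : ∀ s ≤ t, excess l r s < excess l r (t + 1)
  max : ∀ s, excess l r s ≤ excess l r (t + 1)
  eq_set : l' = l.set t r

/-- `l'` arises from `l` by the `r`th raising operator, at some position. -/
def Raise (r : ℕ) (l l' : List ℕ) : Prop := ∃ t, RaiseAt r t l l'

namespace RaiseAt

variable {r t : ℕ} {l l' : List ℕ}

theorem excess_succ (h : RaiseAt r t l l') : excess l r (t + 1) = excess l r t + 1 :=
  le_antisymm (excess_succ_le l r t) (h.first t le_rfl)

theorem pos (h : RaiseAt r t l l') : 0 < excess l r (t + 1) := by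
  have := h.first 0 (Nat.zero_le _)
  rwa [excess_zero] at this

theorem length_eq (h : RaiseAt r t l l') : l'.length = l.length := by simp [h.eq_set]

theorem rowCount_row (h : RaiseAt r t l l') (s : ℕ) :
    rowCount l' r s = rowCount l r s + if t < s then 1 else 0 := by
  have := rowCount_set h.letter r r s
  simpa [h.eq_set] using this

theorem rowCount_row_succ (h : RaiseAt r t l l') (s : ℕ) :
    rowCount l' (r + 1) s + (if t < s then 1 else 0) = rowCount l (r + 1) s := by
  have := rowCount_set h.letter r (r + 1) s
  simpa [h.eq_set] using this

theorem rowCount_of_ne (h : RaiseAt r t l l') {i : ℕ} (h1 : i ≠ r) (h2 : i ≠ r + 1) (s : ℕ) :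
    rowCount l' i s = rowCount l i s := by
  have := rowCount_set h.letter r i s
  simpa [h.eq_set, h1.symm, h2.symm] using this

theorem excess_self (h : RaiseAt r t l l') (s : ℕ) :
    excess l' r s = excess l r s - if t < s then 2 else 0 := by
  have h1 := h.rowCount_row s
  have h2 := h.rowCount_row_succ s
  unfold excess
  split_ifs at * <;> omega

theorem excess_above (h : RaiseAt r t l l') (s : ℕ) :
    excess l' (r + 1) s = excess l (r + 1) s + if t < s then 1 else 0 := by
  have h1 := h.rowCount_of_ne (i := r + 1 + 1) (by omega) (by omega) s
  have h2 := h.rowCount_row_succ s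
  unfold excess
  split_ifs at * <;> omega

theorem excess_below (h : RaiseAt (r + 1) t l l') (s : ℕ) :
    excess l' r s = excess l r s + if t < s then 1 else 0 := by
  have h1 := h.rowCount_of_ne (i := r) (by omega) (by omega) s
  have h2 := h.rowCount_row s
  unfold excess
  split_ifs at * <;> omega

/-- A raising step lowers the maximal surplus. -/
theorem excess_lt (h : RaiseAt r t l l') (s : ℕ) : excess l' r s < excess l r (t + 1) := by
  rw [h.excess_self]
  split_ifs with hs
  · have := h.max s; omega
  · have := h.first s (by omega); omega

/-- The position of a raising step is determined by the word. -/
theorem pos_unique {t₂ : ℕ} {l₂ : List ℕ} (h : RaiseAt r t l l') (h₂ : RaiseAt r t₂ l l₂) :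
    t = t₂ := by
  by_contra hne
  rcases Nat.lt_or_gt_of_ne hne with hlt | hlt
  · have h1 := h.max (t₂ + 1)
    have h2 := h₂.first (t + 1) (by omega)
    omega
  · have h1 := h₂.max (t + 1)
    have h2 := h.first (t₂ + 1) (by omega)
    omega

/-- After a raising step at `t`, the surplus attains its maximum for the last time at `t`. -/
theorem excess_le_target (h : RaiseAt r t l l') (s : ℕ) : excess l' r s ≤ excess l' r t := by
  have h1 := h.excess_lt s
  rw [h.excess_self t, if_neg (lt_irrefl t)]
  have := h.excess_succ
  omega

theorem excess_lt_target (h : RaiseAt r t l l') {s : ℕ} (hs : t < s) :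
    excess l' r s < excess l' r t := by
  rw [h.excess_self t, if_neg (lt_irrefl t), h.excess_self s, if_pos hs]
  have := h.excess_succ
  have := h.max s
  omega

theorem eq_set_target (h : RaiseAt r t l l') : l = l'.set t (r + 1) := by
  have hl := lt_length h.letter
  rw [h.eq_set, List.set_set]
  refine List.ext_getElem? fun j => ?_
  rw [List.getElem?_set]
  split_ifs with h1
  · rw [← h1, h.letter]
  · rfl

end RaiseAt

theorem Raise.rightUnique (r : ℕ) : Relator.RightUnique (Raise r) := by
  rintro l l₁ l₂ ⟨t, h⟩ ⟨t₂, h₂⟩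
  rw [h.eq_set, h₂.eq_set, h.pos_unique h₂]

theorem Raise.leftUnique (r : ℕ) : Relator.RightUnique (Function.swap (Raise r)) := by
  rintro l l₁ l₂ ⟨t, h⟩ ⟨t₂, h₂⟩
  have ht : t = t₂ := by
    by_contra hne
    rcases Nat.lt_or_gt_of_ne hne with hlt | hlt
    · exact absurd (h₂.excess_le_target t) (not_le.2 (h.excess_lt_target hlt))
    · exact absurd (h.excess_le_target t₂) (not_le.2 (h₂.excess_lt_target hlt))
  rw [h.eq_set_target, h₂.eq_set_target, ht]

theorem exists_excess_max (l : List ℕ) (r : ℕ) : ∃ t, ∀ s, excess l r s ≤ excess l r t := by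
  obtain ⟨m, -, hm⟩ :=
    Finset.exists_max_image (Finset.range (l.length + 1)) (excess l r) ⟨0, by simp⟩
  refine ⟨m, fun s => ?_⟩
  by_cases hsl : s ≤ l.length
  · exact hm s (by simpa [Nat.lt_succ_iff] using hsl)
  · rw [excess_of_length_le (by omega)]
    exact hm _ (by simp)

/-- A word in which some prefix has more letters `r + 1` than `r` can be raised. -/
theorem exists_raise {l : List ℕ} {r s : ℕ} (hs : 0 < excess l r s) :
    ∃ t l', RaiseAt r t l l' := by
  obtain ⟨m, hmax⟩ := exists_excess_max l r
  classical
  have hex : ∃ k, excess l r k = excess l r m := ⟨m, rfl⟩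
  have hk := Nat.find_spec hex
  have hlt : ∀ j < Nat.find hex, excess l r j < excess l r m := fun j hj =>
    lt_of_le_of_ne (hmax j) (Nat.find_min hex hj)
  obtain ⟨t, ht⟩ : ∃ t, Nat.find hex = t + 1 := by
    refine Nat.exists_eq_succ_of_ne_zero fun h0 => ?_
    rw [h0, excess_zero] at hk
    have := hmax s
    omega
  rw [ht] at hk hlt
  refine ⟨t, l.set t r, ?_, ?_, ?_, rfl⟩
  · exact getElem?_of_excess_lt (by rw [hk]; exact hlt t (by omega))
  · intro s hs
    rw [hk]
    exact hlt s (by omega)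
  · rw [hk]
    exact hmax

/-- A word in which the surplus does not attain its maximum at the end is the result of a raising
step, whose position is the last one at which the maximum is attained. -/
theorem exists_raise_target {l : List ℕ} {r s : ℕ} (hs : excess l r l.length < excess l r s) :
    ∃ t l', RaiseAt r t l' l := by
  obtain ⟨m, hml, hmax⟩ : ∃ m ≤ l.length, ∀ s, excess l r s ≤ excess l r m := by
    obtain ⟨m, hmax⟩ := exists_excess_max l r
    by_cases hm : m ≤ l.length
    · exact ⟨m, hm, hmax⟩
    · exact ⟨l.length, le_rfl, fun s => by
        rw [← excess_of_length_le (t := m) (by omega)]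
        exact hmax s⟩
  set t := Nat.findGreatest (fun k => excess l r k = excess l r m) l.length with ht
  have hk : excess l r t = excess l r m :=
    Nat.findGreatest_spec (P := fun k => excess l r k = excess l r m) hml rfl
  have htl : t ≤ l.length := Nat.findGreatest_le _
  have hnl : t ≠ l.length := by
    intro h
    rw [h] at hk
    have := hmax s
    omega
  have hlt : ∀ j, t < j → excess l r j < excess l r m := by
    intro j hj
    by_cases hjl : j ≤ l.length
    · exact lt_of_le_of_ne (hmax j)
        (Nat.findGreatest_is_greatest (P := fun k => excess l r k = excess l r m) hj hjl)
    · rw [excess_of_length_le (by omega)]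
      have := hmax s
      omega
  have hlet : l[t]? = some r := getElem?_of_lt_excess (by rw [hk]; exact hlt _ (by omega))
  have hset : ∀ s, excess (l.set t (r + 1)) r s = excess l r s + if t < s then 2 else 0 := by
    intro s
    have h1 := rowCount_set hlet (r + 1) r s
    have h2 := rowCount_set hlet (r + 1) (r + 1) s
    unfold excess
    by_cases hts : t < s <;> simp [hts] at h1 h2 ⊢ <;> omega
  have hstep : excess l r t ≤ excess l r (t + 1) + 1 := by
    unfold excess
    rw [rowCount_succ hlet, rowCount_succ hlet]
    simp
    omega
  refine ⟨t, l.set t (r + 1), by simp [lt_length hlet], ?_, ?_, ?_⟩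
  · intro s hs
    rw [hset, hset, if_neg (by omega), if_pos (by omega)]
    have := hmax s
    omega
  · intro s
    rw [hset, hset, if_pos (show t < t + 1 by omega)]
    have := hmax s
    split_ifs with h
    · have := hlt s h; omega
    · omega
  · rw [List.set_set]
    refine List.ext_getElem? fun j => ?_
    rw [List.getElem?_set]
    split_ifs with h1 h2
    · rw [← h1, hlet]
    · omega
    · rfl

/-- Raising steps can be repeated until no prefix has more letters `r + 1` than `r`. -/
theorem exists_raise_all (r : ℕ) (l : List ℕ) :
    ∃ l', Relation.ReflTransGen (Raise r) l l' ∧ ∀ s, excess l' r s ≤ 0 := by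
  obtain ⟨e, he⟩ : ∃ e : ℕ, ∀ s, excess l r s ≤ e := by
    refine ⟨l.length, fun s => ?_⟩
    have h : rowCount l (r + 1) s ≤ l.length :=
      List.count_le_length.trans (List.length_take_le' _ _)
    unfold excess
    omega
  induction e generalizing l with
  | zero => exact ⟨l, .refl, by simpa using he⟩
  | succ e ih =>
    by_cases hs : ∃ s, 0 < excess l r s
    · obtain ⟨s, hs⟩ := hs
      obtain ⟨t, l₁, h⟩ := exists_raise hs
      obtain ⟨l', h1, h2⟩ := ih l₁ fun s => by
        have := h.excess_lt s
        have := he (t + 1)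
        push_cast at this
        omega
      exact ⟨l', .head ⟨t, h⟩ h1, h2⟩
    · push Not at hs
      exact ⟨l, .refl, hs⟩

/-! ### Tame words -/

/-- A word is tame if the maximum of `#2 - #1` over all prefixes is not exceeded by the sum of the
value of `#1 - #0` at a prefix and of `#2 - #1` at a longer prefix. -/
def IsTame (l : List ℕ) : Prop :=
  ∃ e : ℤ, (∀ s t, s ≤ t → excess l 1 t + excess l 0 s ≤ e) ∧ ∃ t, excess l 1 t = e

/-- On a tame word, the surplus of letters `1` over letters `0` is not positive up to the position
of a raising step that turns a `2` into a `1`. -/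
theorem RaiseAt.excess_zero_nonpos {l l' : List ℕ} {t s : ℕ} (hl : IsTame l)
    (h : RaiseAt 1 t l l') (hs : s ≤ t + 1) : excess l 0 s ≤ 0 := by
  obtain ⟨e, he, t₀, ht₀⟩ := hl
  have h1 := he s (t + 1) hs
  have h2 := h.max t₀
  omega

/-- On a tame word, changing a `1` into a `0` does not raise the maximum of `#2 - #1`. -/
theorem RaiseAt.excess_one_le {l l' : List ℕ} {t : ℕ} {e : ℤ} (hl : IsTame l)
    (h : RaiseAt 0 t l l') (he : ∀ s, excess l 1 s ≤ e) (s : ℕ) : excess l' 1 s ≤ e := by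
  obtain ⟨e₀, he₀, t₀, ht₀⟩ := hl
  rw [h.excess_above]
  have h2 := he t₀
  split_ifs with hs
  · have h3 := he₀ (t + 1) s (by omega)
    have h4 := h.pos
    simp only [zero_add] at *
    omega
  · have := he s
    simpa using this

theorem IsTame.raise_zero {l l' : List ℕ} (hl : IsTame l) (h : Raise 0 l l') : IsTame l' := by
  obtain ⟨t, h⟩ := h
  have hmax := fun e => h.excess_one_le (e := e) hl
  obtain ⟨e, he, t₀, ht₀⟩ := hl
  have he1 : ∀ s, excess l 1 s ≤ e := fun s => by
    have := he 0 s (Nat.zero_le _)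
    rwa [excess_zero, add_zero] at this
  refine ⟨e, fun s u hsu => ?_, t₀, ?_⟩
  · have h1 := h.excess_above u
    have h2 := h.excess_self s
    simp only [zero_add] at h1
    rw [h1, h2]
    have h3 := he s u hsu
    split_ifs with hu hs hs
    · omega
    · have h4 := he (t + 1) u (by omega)
      have h5 := h.first s (by omega)
      omega
    · omega
    · omega
  · refine le_antisymm (hmax e he1 t₀) ?_
    have h1 := h.excess_above t₀
    simp only [zero_add] at h1
    rw [h1, ht₀]
    split_ifs <;> omega

theorem IsTame.raise_one {l l' : List ℕ} (hl : IsTame l) (h : Raise 1 l l') : IsTame l' := by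
  obtain ⟨t, h⟩ := h
  have hneg : ∀ s ≤ t + 1, excess l 0 s ≤ 0 := fun s hs => h.excess_zero_nonpos hl hs
  obtain ⟨e, he, t₀, ht₀⟩ := hl
  have he' : excess l 1 (t + 1) = e := by
    refine le_antisymm ?_ (ht₀ ▸ h.max t₀)
    have := he 0 (t + 1) (Nat.zero_le _)
    rwa [excess_zero, add_zero] at this
  refine ⟨e - 1, fun s u hsu => ?_, t, ?_⟩
  · have h1 := h.excess_self u
    have h2 := h.excess_below s
    rw [h1, h2]
    have h3 := he s u hsu
    split_ifs with hu hs hs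
    · omega
    · omega
    · omega
    · have h4 := h.first u (by omega)
      have h5 := hneg s (by omega)
      omega
  · have h1 := h.excess_self t
    have h2 := h.excess_succ
    simp only [lt_irrefl, if_false] at h1
    omega

/-- Tameness is also inherited backwards along a raising step `1 ↦ 0`, if the word has no prefix
with more letters `2` than `1`. -/
theorem IsTame.of_raise_zero {l l' : List ℕ} (h : Raise 0 l' l)
    (hl : ∀ s t, s ≤ t → excess l 1 t + excess l 0 s ≤ 0) :
    ∀ s t, s ≤ t → excess l' 1 t + excess l' 0 s ≤ 0 := by
  obtain ⟨t, h⟩ := h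
  intro s u hsu
  have h1 := h.excess_above u
  have h2 := h.excess_self s
  have h3 := hl s u hsu
  simp only [zero_add] at h1
  split_ifs at h1 h2 with hu hs hs
  · have h4 := h.excess_lt_target hs
    have h5 := hl t u (by omega)
    omega
  · omega
  · omega
  · omega

/-- Tameness is inherited backwards along a raising step `2 ↦ 1`. -/
theorem IsTame.of_raise_one {l l' : List ℕ} (h : Raise 1 l' l) (hl : IsTame l) : IsTame l' := by
  obtain ⟨t, h⟩ := h
  obtain ⟨e, he, t₀, ht₀⟩ := hl
  have he' : excess l 1 t = e := by
    refine le_antisymm ?_ (ht₀ ▸ h.excess_le_target t₀)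
    have := he 0 t (Nat.zero_le _)
    rwa [excess_zero, add_zero] at this
  refine ⟨e + 1, fun s u hsu => ?_, t + 1, ?_⟩
  · have h1 := h.excess_self u
    have h2 := h.excess_below s
    have h3 := he s u hsu
    split_ifs at h1 h2 with hu hs hs
    · omega
    · have h4 := h.excess_lt_target hu
      have h5 := he s t (by omega)
      omega
    · omega
    · omega
  · have h1 := h.excess_self t
    have h2 := h.excess_succ
    simp only [lt_irrefl, if_false] at h1
    omega

/-- On tame words the two raising operators commute: the step `2 ↦ 1` takes place to the left of
the step `1 ↦ 0`, and neither displaces the other. -/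
theorem Raise.commute {l u v : List ℕ} (hl : IsTame l) (hu : Raise 0 l u) (hv : Raise 1 l v) :
    ∃ x, Raise 1 u x ∧ Raise 0 v x := by
  obtain ⟨t₀, hu⟩ := hu
  obtain ⟨t₁, hv⟩ := hv
  have hlt : t₁ < t₀ := by
    by_contra hle
    have h1 := hv.excess_zero_nonpos hl (s := t₀ + 1) (by omega)
    have h2 := hu.pos
    omega
  have hmax := hu.excess_one_le hl hv.max
  refine ⟨u.set t₁ 1, ⟨t₁, ?_, ?_, ?_, rfl⟩, ⟨t₀, ?_, ?_, ?_, ?_⟩⟩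
  · rw [hu.eq_set, List.getElem?_set, if_neg (by omega)]
    exact hv.letter
  · intro s hs
    have h1 := hu.excess_above s
    have h2 := hu.excess_above (t₁ + 1)
    simp only [zero_add] at h1 h2
    rw [h1, h2, if_neg (by omega), if_neg (by omega)]
    simpa using hv.first s hs
  · intro s
    have h2 := hu.excess_above (t₁ + 1)
    simp only [zero_add] at h2
    rw [h2, if_neg (by omega), add_zero]
    exact hmax s
  · rw [hv.eq_set, List.getElem?_set, if_neg (by omega)]
    exact hu.letter
  · intro s hs
    have h1 := hv.excess_below s
    have h2 := hv.excess_below (t₀ + 1)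
    have h3 := hu.first s hs
    rw [h1, h2, if_pos (show t₁ < t₀ + 1 by omega)]
    split_ifs <;> omega
  · intro s
    have h1 := hv.excess_below s
    have h2 := hv.excess_below (t₀ + 1)
    have h3 := hu.max s
    rw [h1, h2, if_pos (show t₁ < t₀ + 1 by omega)]
    split_ifs <;> omega
  · rw [hu.eq_set, hv.eq_set, List.set_comm _ _ (by omega)]

/-- One raising step, of either kind, on a tame word. -/
def Step (l l' : List ℕ) : Prop := IsTame l ∧ (Raise 0 l l' ∨ Raise 1 l l')

theorem Step.isTame {l l' : List ℕ} (h : Step l l') : IsTame l' :=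
  h.2.elim h.1.raise_zero h.1.raise_one

theorem isTame_of_steps {l l' : List ℕ} (hl : IsTame l) (h : Relation.ReflTransGen Step l l') :
    IsTame l' := by
  induction h with
  | refl => exact hl
  | tail _ h _ => exact h.isTame

theorem Step.diamond {l u v : List ℕ} (hu : Step l u) (hv : Step l v) :
    ∃ x, Relation.ReflGen Step u x ∧ Relation.ReflTransGen Step v x := by
  have hut := hu.isTame
  have hvt := hv.isTame
  obtain ⟨hl, hu | hu⟩ := hu <;> obtain ⟨-, hv | hv⟩ := hv
  · rw [Raise.rightUnique 0 hu hv]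
    exact ⟨v, .refl, .refl⟩
  · obtain ⟨x, h1, h2⟩ := Raise.commute hl hu hv
    exact ⟨x, .single ⟨hut, .inr h1⟩, .single ⟨hvt, .inl h2⟩⟩
  · obtain ⟨x, h1, h2⟩ := Raise.commute hl hv hu
    exact ⟨x, .single ⟨hut, .inl h2⟩, .single ⟨hvt, .inr h1⟩⟩
  · rw [Raise.rightUnique 1 hu hv]
    exact ⟨v, .refl, .refl⟩

/-- A word that is dominant for the letters `0`, `1`, `2`: no prefix has more letters `1` than `0`
or more letters `2` than `1`. -/
def IsDominant (l : List ℕ) : Prop := ∀ s, excess l 0 s ≤ 0 ∧ excess l 1 s ≤ 0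

theorem IsDominant.eq_of_steps {l l' : List ℕ} (hl : IsDominant l)
    (h : Relation.ReflTransGen Step l l') : l = l' := by
  rcases Relation.ReflTransGen.cases_head h with h | ⟨x, ⟨-, ⟨t, h⟩ | ⟨t, h⟩⟩, -⟩
  · exact h
  · exact absurd h.pos (not_lt.2 (hl _).1)
  · exact absurd h.pos (not_lt.2 (hl _).2)

/-- All chains of raising steps from a word to a dominant word end at the same word. -/
theorem IsDominant.unique {l u v : List ℕ} (hu : IsDominant u) (hv : IsDominant v)
    (h : Relation.ReflTransGen Step l u) (h' : Relation.ReflTransGen Step l v) : u = v := by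
  obtain ⟨x, h1, h2⟩ := Relation.church_rosser (fun _ _ _ => Step.diamond) h h'
  rw [hu.eq_of_steps h1, hv.eq_of_steps h2]

theorem steps_of_raise_zero {l l' : List ℕ} (hl : IsTame l)
    (h : Relation.ReflTransGen (Raise 0) l l') : Relation.ReflTransGen Step l l' := by
  induction h with
  | refl => exact .refl
  | tail _ h ih => exact ih.tail ⟨isTame_of_steps hl ih, .inl h⟩

theorem steps_of_raise_one {l l' : List ℕ} (hl : IsTame l)
    (h : Relation.ReflTransGen (Raise 1) l l') : Relation.ReflTransGen Step l l' := by
  induction h with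
  | refl => exact .refl
  | tail _ h ih => exact ih.tail ⟨isTame_of_steps hl ih, .inr h⟩

/-! ### Motzkin words and dominant words -/

/-- The words that correspond to Motzkin paths: no prefix has more letters `1` than `0`, and the
whole word has as many. -/
def IsMotzkin (l : List ℕ) : Prop := (∀ s, excess l 0 s ≤ 0) ∧ excess l 0 l.length = 0

theorem IsMotzkin.isTame {l : List ℕ} (hl : IsMotzkin l) : IsTame l := by
  obtain ⟨m, hm⟩ := exists_excess_max l 1
  refine ⟨_, fun s t _ => ?_, m, rfl⟩
  have h1 := hm t
  have h2 := hl.1 s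
  omega

theorem IsDominant.isTame {l : List ℕ} (hl : IsDominant l) : IsTame l := by
  refine ⟨0, fun s t _ => ?_, 0, excess_zero _ _⟩
  have h1 := (hl t).2
  have h2 := (hl s).1
  omega

/-- From a Motzkin word, all `2`s that exceed the `1`s are raised first; afterwards the surplus of
letters `1` over letters `0` attains its maximum at the end, and raising these `1`s gives a
dominant word. -/
theorem IsMotzkin.exists_steps {l : List ℕ} (hl : IsMotzkin l) :
    ∃ y v, Relation.ReflTransGen (Raise 1) l y ∧ Relation.ReflTransGen (Raise 0) y v ∧
      (∀ s, excess y 0 s ≤ excess y 0 y.length) ∧ IsDominant v := by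
  obtain ⟨y, hy, hy1⟩ := exists_raise_all 1 l
  obtain ⟨v, hv, hv0⟩ := exists_raise_all 0 y
  refine ⟨y, v, hy, hv, ?_, fun s => ⟨hv0 s, ?_⟩⟩
  · clear hv hv0 hy1
    induction hy with
    | refl => simpa [hl.2] using hl.1
    | tail _ h ih =>
      obtain ⟨t, h⟩ := h
      intro s
      have h1 := lt_length h.letter
      rw [h.excess_below, h.excess_below, h.length_eq, if_pos h1]
      have := ih s
      split_ifs <;> omega
  · have hyt := isTame_of_steps hl.isTame (steps_of_raise_one hl.isTame hy)
    have key : IsTame v ∧ ∀ s, excess v 1 s ≤ 0 := by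
      clear hv0
      induction hv with
      | refl => exact ⟨hyt, hy1⟩
      | tail _ h ih =>
        refine ⟨ih.1.raise_zero h, ?_⟩
        obtain ⟨t, h⟩ := h
        exact h.excess_one_le ih.1 ih.2
    exact key.2 s

theorem IsMotzkin.exists_dominant {l : List ℕ} (hl : IsMotzkin l) :
    ∃ v, Relation.ReflTransGen Step l v ∧ IsDominant v := by
  obtain ⟨y, v, hy, hv, -, hd⟩ := hl.exists_steps
  have h1 := steps_of_raise_one hl.isTame hy
  exact ⟨v, h1.trans (steps_of_raise_zero (isTame_of_steps hl.isTame h1) hv), hd⟩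

/-- A chain of raising steps `1 ↦ 0` between two words whose surplus attains its maximum at the
end is trivial, since such a step leaves the maximum strictly above the value at the end. -/
theorem eq_of_raise_zero {y z : List ℕ} (h : Relation.ReflTransGen (Raise 0) y z)
    (hz : ∀ s, excess z 0 s ≤ excess z 0 z.length) : y = z := by
  rcases Relation.ReflTransGen.cases_tail h with h | ⟨x, -, t, h⟩
  · exact h.symm
  · have h1 := lt_length h.letter
    have h2 := h.excess_lt_target (s := z.length) (by rw [h.length_eq]; exact h1)
    exact absurd (hz t) (not_le.2 h2)

/-- A chain of raising steps `2 ↦ 1` between two Motzkin words is trivial, since such a step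
increases the number of letters `1`. -/
theorem IsMotzkin.eq_of_raise_one {y z : List ℕ} (hy : IsMotzkin y) (hz : IsMotzkin z)
    (h : Relation.ReflTransGen (Raise 1) y z) : y = z := by
  have key : y = z ∨ (z.length = y.length ∧ excess y 0 y.length < excess z 0 z.length) := by
    clear hz
    induction h with
    | refl => exact .inl rfl
    | @tail b c _ h ih =>
      right
      obtain ⟨t, h⟩ := h
      have h1 := lt_length h.letter
      have h2 := h.excess_below b.length
      rw [if_pos h1] at h2
      rw [h.length_eq]
      rcases ih with rfl | ⟨h3, h4⟩
      · exact ⟨rfl, by omega⟩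
      · exact ⟨h3, by omega⟩
  rcases key with h | ⟨-, h⟩
  · exact h
  · rw [hy.2, hz.2] at h
    exact absurd h (lt_irrefl _)

/-- Different Motzkin words have different dominant words. -/
theorem IsMotzkin.injective {l l' v : List ℕ} (hl : IsMotzkin l) (hl' : IsMotzkin l')
    (hv : IsDominant v) (h : Relation.ReflTransGen Step l v)
    (h' : Relation.ReflTransGen Step l' v) : l = l' := by
  obtain ⟨y, v₁, hy, hv₁, hmax, hd⟩ := hl.exists_steps
  obtain ⟨y', v₂, hy', hv₂, hmax', hd'⟩ := hl'.exists_steps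
  have h1 := steps_of_raise_one hl.isTame hy
  have h1' := steps_of_raise_one hl'.isTame hy'
  have e1 : v₁ = v :=
    hd.unique hv (h1.trans (steps_of_raise_zero (isTame_of_steps hl.isTame h1) hv₁)) h
  have e2 : v₂ = v :=
    hd'.unique hv (h1'.trans (steps_of_raise_zero (isTame_of_steps hl'.isTame h1') hv₂)) h'
  subst e1 e2
  have hyy : y = y' := by
    rcases Relation.ReflTransGen.total_of_right_unique (Raise.leftUnique 0)
      (Relation.reflTransGen_swap.2 hv₁) (Relation.reflTransGen_swap.2 hv₂) with h | h
    · exact (eq_of_raise_zero (Relation.reflTransGen_swap.1 h) hmax).symm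
    · exact eq_of_raise_zero (Relation.reflTransGen_swap.1 h) hmax'
  subst hyy
  rcases Relation.ReflTransGen.total_of_right_unique (Raise.leftUnique 1)
    (Relation.reflTransGen_swap.2 hy) (Relation.reflTransGen_swap.2 hy') with h | h
  · exact (hl'.eq_of_raise_one hl (Relation.reflTransGen_swap.1 h)).symm
  · exact hl.eq_of_raise_one hl' (Relation.reflTransGen_swap.1 h)

/-- Undoing raising steps `1 ↦ 0` as long as possible. -/
theorem exists_lowered_zero {v : List ℕ} (hv : ∀ s t, s ≤ t → excess v 1 t + excess v 0 s ≤ 0) :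
    ∃ y, Relation.ReflTransGen (Raise 0) y v ∧
      (∀ s t, s ≤ t → excess y 1 t + excess y 0 s ≤ 0) ∧
      ∀ s, excess y 0 s ≤ excess y 0 y.length := by
  obtain ⟨m, hm⟩ := exists_excess_max v 0
  obtain ⟨g, hg⟩ : ∃ g : ℕ, ∀ s, excess v 0 s ≤ excess v 0 v.length + g :=
    ⟨(excess v 0 m - excess v 0 v.length).toNat, fun s => by have := hm s; omega⟩
  clear hm
  induction g generalizing v with
  | zero => exact ⟨v, .refl, hv, by simpa using hg⟩
  | succ g ih =>
    by_cases hs : ∃ s, excess v 0 v.length < excess v 0 s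
    · obtain ⟨s, hs⟩ := hs
      obtain ⟨t, l, h⟩ := exists_raise_target hs
      obtain ⟨y, h1, h2, h3⟩ := ih (IsTame.of_raise_zero ⟨t, h⟩ hv) fun s => by
        have h4 := h.max s
        have h5 := h.excess_self t
        have h6 := h.excess_succ
        have h7 := h.excess_self v.length
        rw [if_pos (by rw [h.length_eq]; exact lt_length h.letter)] at h7
        rw [if_neg (lt_irrefl t)] at h5
        have h8 := hg t
        rw [← h.length_eq]
        push_cast at h8
        omega
      exact ⟨y, h1.tail ⟨t, h⟩, h2, h3⟩
    · push Not at hs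
      exact ⟨v, .refl, hv, hs⟩

/-- Undoing raising steps `2 ↦ 1` until no prefix has more letters `1` than `0`. -/
theorem exists_lowered_one {y : List ℕ} (hy : IsTame y)
    (hmax : ∀ s, excess y 0 s ≤ excess y 0 y.length) :
    ∃ l, Relation.ReflTransGen (Raise 1) l y ∧ IsMotzkin l := by
  obtain ⟨g, hg⟩ : ∃ g : ℕ, excess y 0 y.length = g := by
    have := hmax 0
    rw [excess_zero] at this
    exact ⟨_, (Int.toNat_of_nonneg this).symm⟩
  induction g generalizing y with
  | zero =>
    refine ⟨y, .refl, fun s => ?_, by simpa using hg⟩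
    have := hmax s
    simp only [hg] at this
    simpa using this
  | succ g ih =>
    -- If the maximum of `#2 - #1` were attained at the end, tameness would bound `#1 - #0` by `0`.
    obtain ⟨s, hs⟩ : ∃ s, excess y 1 y.length < excess y 1 s := by
      obtain ⟨e, he, s, hs⟩ := hy
      have := he y.length y.length le_rfl
      refine ⟨s, ?_⟩
      push_cast at hg
      omega
    obtain ⟨t, l, h⟩ := exists_raise_target hs
    have ht := lt_length h.letter
    have hend := h.excess_below y.length
    rw [if_pos (by rw [h.length_eq]; exact ht)] at hend
    have hlt := IsTame.of_raise_one ⟨t, h⟩ hy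
    obtain ⟨x, h1, h2⟩ := ih hlt (fun s => by
      rw [← h.length_eq]
      by_cases hts : t < s
      · have h3 := h.excess_below s
        rw [if_pos hts] at h3
        have := hmax s
        omega
      · have h3 := h.excess_zero_nonpos hlt (s := s) (by omega)
        push_cast at hg
        omega) (by rw [← h.length_eq]; push_cast at hg; omega)
    exact ⟨x, h1.tail ⟨t, h⟩, h2⟩

/-- Every dominant word comes from a Motzkin word. -/
theorem IsDominant.exists_isMotzkin {v : List ℕ} (hv : IsDominant v) :
    ∃ l, IsMotzkin l ∧ Relation.ReflTransGen Step l v := by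
  obtain ⟨y, hyv, hy, hmax⟩ := exists_lowered_zero (v := v) fun s t _ => by
    have h1 := (hv t).2
    have h2 := (hv s).1
    omega
  have hyt : IsTame y := ⟨0, hy, 0, excess_zero _ _⟩
  obtain ⟨l, hly, hl⟩ := exists_lowered_one hyt hmax
  exact ⟨l, hl, (steps_of_raise_one hl.isTame hly).trans (steps_of_raise_zero hyt hyv)⟩

/-! ### Length, letters and descents -/

/-- A word of length `n` in the letters `0`, `1`, `2`. -/
def IsWord (n : ℕ) (l : List ℕ) : Prop := l.length = n ∧ ∀ x ∈ l, x < 3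

theorem Step.isWord_iff {n : ℕ} {l l' : List ℕ} (h : Step l l') : IsWord n l ↔ IsWord n l' := by
  have key : ∀ r t, r < 2 → RaiseAt r t l l' → (IsWord n l ↔ IsWord n l') := by
    intro r t hr h
    unfold IsWord
    rw [h.length_eq]
    refine and_congr_right fun _ => ⟨fun hx x hxl => ?_, fun hx x hxl => ?_⟩
    · rw [h.eq_set] at hxl
      rcases List.mem_or_eq_of_mem_set hxl with hxl | rfl
      · exact hx x hxl
      · omega
    · rw [h.eq_set_target] at hxl
      rcases List.mem_or_eq_of_mem_set hxl with hxl | rfl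
      · exact hx x hxl
      · omega
  obtain ⟨-, ⟨t, h⟩ | ⟨t, h⟩⟩ := h
  · exact key 0 t (by omega) h
  · exact key 1 t (by omega) h

theorem isWord_iff_of_steps {n : ℕ} {l l' : List ℕ} (h : Relation.ReflTransGen Step l l') :
    IsWord n l ↔ IsWord n l' := by
  induction h with
  | refl => rfl
  | tail _ h ih => exact ih.trans h.isWord_iff

/-- The descents of a word: the numbers `i ≥ 1` such that the `i`th letter (counted from `1`) is
smaller than the next one. They become tableau descents, rows being numbered downwards. -/
def descents (l : List ℕ) : Set ℕ :=
  {i | 1 ≤ i ∧ ∃ a b, l[i - 1]? = some a ∧ l[i]? = some b ∧ a < b}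

/-- Raising steps preserve descents: next to the changed letter, the only neighbours that would
matter are an `r` on its left and an `r + 1` on its right, and they would contradict the choice of
the position. -/
theorem RaiseAt.descents_eq {r t : ℕ} {l l' : List ℕ} (h : RaiseAt r t l l') :
    descents l' = descents l := by
  have htl := lt_length h.letter
  have hget : ∀ j, l'[j]? = if t = j then some r else l[j]? := by
    intro j
    rw [h.eq_set, List.getElem?_set]
    split_ifs <;> rfl
  ext i
  refine and_congr_right fun hi => ?_
  rw [hget, hget]
  by_cases h1 : t = i
  · subst h1
    rw [if_neg (by omega), if_pos rfl, h.letter]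
    have hne : l[t - 1]? ≠ some r := by
      intro h2
      have h3 : excess l r (t - 1 + 1) = excess l r (t - 1) - 1 := by
        unfold excess
        rw [rowCount_succ h2, rowCount_succ h2]
        simp
        omega
      rw [Nat.sub_add_cancel hi] at h3
      have h4 := h.first (t - 1) (by omega)
      have h5 := h.excess_succ
      omega
    constructor
    · rintro ⟨a, b, ha, hb, hab⟩
      cases hb
      exact ⟨a, r + 1, ha, rfl, by omega⟩
    · rintro ⟨a, b, ha, hb, hab⟩
      cases hb
      have : a ≠ r := fun h => hne (h ▸ ha)
      exact ⟨a, r, ha, rfl, by omega⟩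
  · rw [if_neg h1]
    by_cases h2 : t = i - 1
    · subst h2
      rw [if_pos rfl, h.letter]
      have hne : l[i]? ≠ some (r + 1) := by
        intro h2
        have h3 : excess l r (i + 1) = excess l r i + 1 := by
          unfold excess
          rw [rowCount_succ h2, rowCount_succ h2]
          simp
          omega
        have h4 := h.max (i + 1)
        rw [Nat.sub_add_cancel hi] at h4
        omega
      constructor
      · rintro ⟨a, b, ha, hb, hab⟩
        cases ha
        have : b ≠ r + 1 := fun h => hne (h ▸ hb)
        exact ⟨r + 1, b, rfl, hb, by omega⟩
      · rintro ⟨a, b, ha, hb, hab⟩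
        cases ha
        exact ⟨r, b, rfl, hb, by omega⟩
    · rw [if_neg h2]

theorem descents_eq_of_steps {l l' : List ℕ} (h : Relation.ReflTransGen Step l l') :
    descents l' = descents l := by
  induction h with
  | refl => rfl
  | tail _ h ih =>
    obtain ⟨-, ⟨t, h⟩ | ⟨t, h⟩⟩ := h
    · exact h.descents_eq.trans ih
    · exact h.descents_eq.trans ih

end RowWord

/-! ### Tableaux and their row words -/

namespace RowWord

theorem rowCount_lt {l : List ℕ} {v w i : ℕ} (h : l[v]? = some i) (hvw : v < w) :
    rowCount l i v < rowCount l i w := by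
  have h1 := rowCount_succ h i
  rw [if_pos rfl] at h1
  have h2 := rowCount_mono l i (show v + 1 ≤ w from hvw)
  omega

theorem lt_of_rowCount_lt {l : List ℕ} {v w i : ℕ} (h : rowCount l i v < rowCount l i w) :
    v < w := by
  by_contra hle
  have := rowCount_mono l i (not_lt.1 hle)
  omega

theorem exists_rowCount_eq {l : List ℕ} {i m t : ℕ} (h : m < rowCount l i t) :
    ∃ v < t, l[v]? = some i ∧ rowCount l i v = m := by
  induction t with
  | zero => simp at h
  | succ t ih =>
    by_cases ht : m < rowCount l i t
    · obtain ⟨v, h1, h2⟩ := ih ht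
      exact ⟨v, by omega, h2⟩
    · rcases hx : l[t]? with _ | x
      · have h' : l.length ≤ t := by simpa using hx
        rw [rowCount_of_length_le (by omega)] at h ht
        omega
      · rw [rowCount_succ hx] at h
        by_cases hxi : x = i
        · rw [if_pos hxi] at h
          exact ⟨t, by omega, hxi ▸ hx, by omega⟩
        · rw [if_neg hxi] at h
          omega

/-- The cell that receives the entry `v + 1` when each row is filled from left to right, to the
right of the diagram `mu`, according to the row word `l`. -/
def pos (l : List ℕ) (mu : YoungDiagram) (v : ℕ) : ℕ × ℕ :=
  (l.getD v 0, mu.rowLen (l.getD v 0) + rowCount l (l.getD v 0) v)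

theorem pos_eq {l : List ℕ} {v x : ℕ} (h : l[v]? = some x) (mu : YoungDiagram) :
    pos l mu v = (x, mu.rowLen x + rowCount l x v) := by
  simp [pos, h]

theorem exists_getElem? {l : List ℕ} {v : ℕ} (h : v < l.length) : ∃ x, l[v]? = some x :=
  ⟨_, List.getElem?_eq_getElem h⟩

theorem pos_injective {l : List ℕ} {mu : YoungDiagram} {v w : ℕ} (hv : v < l.length)
    (hw : w < l.length) (h : pos l mu v = pos l mu w) : v = w := by
  obtain ⟨x, hx⟩ := exists_getElem? hv
  obtain ⟨y, hy⟩ := exists_getElem? hw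
  rw [pos_eq hx, pos_eq hy, Prod.mk.injEq] at h
  obtain ⟨rfl, h⟩ := h
  rcases lt_trichotomy v w with hlt | rfl | hlt
  · have := rowCount_lt hx hlt; omega
  · rfl
  · have := rowCount_lt hy hlt; omega

theorem exists_pos_eq {l : List ℕ} {mu : YoungDiagram} {i j : ℕ} (h1 : mu.rowLen i ≤ j)
    (h2 : j < mu.rowLen i + rowCount l i l.length) :
    ∃ v < l.length, l[v]? = some i ∧ pos l mu v = (i, j) := by
  obtain ⟨v, hv, hx, hc⟩ := exists_rowCount_eq (m := j - mu.rowLen i) (l := l) (i := i)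
    (t := l.length) (by omega)
  refine ⟨v, hv, hx, ?_⟩
  rw [pos_eq hx, hc]
  congr 1
  omega

/-- The filling with the entry `v + 1` in the cell `pos l mu v`; the sum has at most one nonzero
term. -/
def filling (l : List ℕ) (mu : YoungDiagram) (c : ℕ × ℕ) : ℕ :=
  ∑ v ∈ Finset.range l.length, if pos l mu v = c then v + 1 else 0

theorem filling_pos {l : List ℕ} {mu : YoungDiagram} {v : ℕ} (hv : v < l.length) :
    filling l mu (pos l mu v) = v + 1 := by
  rw [filling, Finset.sum_eq_single v]
  · simp
  · intro w hw hne
    rw [if_neg]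
    intro h
    exact hne (pos_injective (Finset.mem_range.1 hw) hv h)
  · simp [hv]

theorem filling_of_getElem? {l : List ℕ} {mu : YoungDiagram} {v i j : ℕ} (h : l[v]? = some i)
    (hj : mu.rowLen i + rowCount l i v = j) : filling l mu (i, j) = v + 1 := by
  rw [← hj, ← pos_eq h, filling_pos (lt_length h)]

theorem filling_eq_zero {l : List ℕ} {mu : YoungDiagram} {c : ℕ × ℕ}
    (h : ∀ v < l.length, pos l mu v ≠ c) : filling l mu c = 0 :=
  Finset.sum_eq_zero fun v hv => if_neg (h v (Finset.mem_range.1 hv))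

theorem filling_eq_zero_of_lt {l : List ℕ} {mu : YoungDiagram} {i j : ℕ} (h : j < mu.rowLen i) :
    filling l mu (i, j) = 0 := by
  refine filling_eq_zero fun v hv heq => ?_
  obtain ⟨x, hx⟩ := exists_getElem? hv
  rw [pos_eq hx, Prod.mk.injEq] at heq
  obtain ⟨rfl, heq⟩ := heq
  omega

theorem filling_eq_zero_of_ge {l : List ℕ} {mu : YoungDiagram} {i j : ℕ}
    (h : mu.rowLen i + rowCount l i l.length ≤ j) : filling l mu (i, j) = 0 := by
  refine filling_eq_zero fun v hv heq => ?_
  obtain ⟨x, hx⟩ := exists_getElem? hv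
  rw [pos_eq hx, Prod.mk.injEq] at heq
  obtain ⟨rfl, heq⟩ := heq
  have := rowCount_lt hx hv
  omega

/-- A filling is the one of the word `l` as soon as it has the right value at the cells `pos l mu v`
and vanishes elsewhere. -/
theorem eq_filling {l : List ℕ} {mu : YoungDiagram} {f : ℕ × ℕ → ℕ}
    (h1 : ∀ v < l.length, f (pos l mu v) = v + 1)
    (h2 : ∀ c, (∀ v < l.length, pos l mu v ≠ c) → f c = 0) : f = filling l mu := by
  funext c
  by_cases hc : ∃ v < l.length, pos l mu v = c
  · obtain ⟨v, hv, rfl⟩ := hc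
    rw [h1 v hv, filling_pos hv]
  · push Not at hc
    rw [h2 c hc, filling_eq_zero hc]

/-- The word `l` of length `n` is the row word of a skew tableau with inner shape `mu`: at each
stage, the rows filled so far form a partition. -/
structure IsLattice (n : ℕ) (l : List ℕ) (mu : YoungDiagram) : Prop where
  length_eq : l.length = n
  ballot : ∀ i t, mu.rowLen (i + 1) + rowCount l (i + 1) t ≤ mu.rowLen i + rowCount l i t

theorem IsLattice.anti {n : ℕ} {l : List ℕ} {mu : YoungDiagram} (h : IsLattice n l mu) (t : ℕ)
    {i₁ i₂ : ℕ} (hi : i₁ ≤ i₂) :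
    mu.rowLen i₂ + rowCount l i₂ t ≤ mu.rowLen i₁ + rowCount l i₁ t :=
  antitone_nat_of_succ_le (f := fun i => mu.rowLen i + rowCount l i t) (fun i => h.ballot i t) hi

theorem mem_union_image_pos {l : List ℕ} {mu : YoungDiagram} {i j : ℕ} :
    (i, j) ∈ mu.cells ∪ (Finset.range l.length).image (pos l mu) ↔
      j < mu.rowLen i + rowCount l i l.length := by
  rw [Finset.mem_union, YoungDiagram.mem_cells, YoungDiagram.mem_iff_lt_rowLen, Finset.mem_image]
  constructor
  · rintro (h | ⟨v, hv, h⟩)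
    · omega
    · rw [Finset.mem_range] at hv
      obtain ⟨x, hx⟩ := exists_getElem? hv
      rw [pos_eq hx, Prod.mk.injEq] at h
      obtain ⟨rfl, rfl⟩ := h
      have := rowCount_lt hx hv
      omega
  · intro h
    by_cases hj : j < mu.rowLen i
    · exact .inl hj
    · obtain ⟨v, hv, -, h⟩ := exists_pos_eq (not_lt.1 hj) h
      exact .inr ⟨v, Finset.mem_range.2 hv, h⟩

/-- The outer shape of the tableau with row word `l` and inner shape `mu`. -/
def outerShape {n : ℕ} {l : List ℕ} {mu : YoungDiagram} (h : IsLattice n l mu) : YoungDiagram where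
  cells := mu.cells ∪ (Finset.range l.length).image (pos l mu)
  isLowerSet := by
    rintro ⟨i, j⟩ ⟨i', j'⟩ hle hc
    rw [Finset.mem_coe, mem_union_image_pos] at hc ⊢
    obtain ⟨hi, hj⟩ := Prod.mk_le_mk.1 hle
    have := h.anti l.length hi
    omega

theorem mem_outerShape {n : ℕ} {l : List ℕ} {mu : YoungDiagram} (h : IsLattice n l mu) {i j : ℕ} :
    (i, j) ∈ outerShape h ↔ j < mu.rowLen i + rowCount l i l.length := by
  rw [← mem_union_image_pos, ← YoungDiagram.mem_cells]
  rfl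

theorem outerShape_sdiff {n : ℕ} {l : List ℕ} {mu : YoungDiagram} (h : IsLattice n l mu) :
    (outerShape h).cells \ mu.cells = (Finset.range l.length).image (pos l mu) := by
  rw [outerShape, Finset.union_sdiff_left, Finset.sdiff_eq_self_iff_disjoint,
    Finset.disjoint_right]
  rintro ⟨i, j⟩ h1 h2
  obtain ⟨v, hv, h⟩ := Finset.mem_image.1 h2
  rw [YoungDiagram.mem_cells, YoungDiagram.mem_iff_lt_rowLen] at h1
  obtain ⟨x, hx⟩ := exists_getElem? (Finset.mem_range.1 hv)
  rw [pos_eq hx, Prod.mk.injEq] at h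
  obtain ⟨rfl, rfl⟩ := h
  omega

/-- The skew tableau with row word `l` and inner shape `mu`. -/
def tableau {n : ℕ} {l : List ℕ} {mu : YoungDiagram} (h : IsLattice n l mu) : SkewSYT n where
  inner := mu
  outer := outerShape h
  inner_le := YoungDiagram.cells_subset_iff.1 Finset.subset_union_left
  entry := filling l mu
  entry_zero c hc := by
    rw [outerShape_sdiff] at hc
    exact filling_eq_zero fun v hv heq =>
      hc (Finset.mem_image.2 ⟨v, Finset.mem_range.2 hv, heq⟩)
  entry_bijOn := by
    rw [outerShape_sdiff, Finset.coe_image, Finset.coe_range]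
    refine ⟨?_, ?_, ?_⟩
    · rintro _ ⟨v, hv, rfl⟩
      have hv' : v < l.length := hv
      rw [filling_pos hv, Set.mem_Icc, ← h.length_eq]
      omega
    · rintro _ ⟨v, hv, rfl⟩ _ ⟨w, hw, rfl⟩ heq
      rw [filling_pos hv, filling_pos hw] at heq
      rw [Nat.add_right_cancel heq]
    · intro v hv
      rw [Set.mem_Icc, ← h.length_eq] at hv
      have hv' : v - 1 < l.length := by omega
      refine ⟨_, ⟨v - 1, hv', rfl⟩, ?_⟩
      rw [filling_pos hv']
      omega
  row_strict := by
    intro i j₁ j₂ hj h1 h2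
    rw [outerShape_sdiff, Finset.mem_image] at h1 h2
    obtain ⟨v, hv, h1⟩ := h1
    obtain ⟨w, hw, h2⟩ := h2
    rw [Finset.mem_range] at hv hw
    rw [← h1, ← h2, filling_pos hv, filling_pos hw]
    obtain ⟨x, hx⟩ := exists_getElem? hv
    obtain ⟨y, hy⟩ := exists_getElem? hw
    rw [pos_eq hx, Prod.mk.injEq] at h1
    rw [pos_eq hy, Prod.mk.injEq] at h2
    obtain ⟨rfl, rfl⟩ := h1
    obtain ⟨rfl, rfl⟩ := h2
    have := lt_of_rowCount_lt (l := l) (i := y) (v := v) (w := w) (by omega)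
    omega
  col_strict := by
    intro i₁ i₂ j hi h1 h2
    rw [outerShape_sdiff, Finset.mem_image] at h1 h2
    obtain ⟨v, hv, h1⟩ := h1
    obtain ⟨w, hw, h2⟩ := h2
    rw [Finset.mem_range] at hv hw
    rw [← h1, ← h2, filling_pos hv, filling_pos hw]
    obtain ⟨x, hx⟩ := exists_getElem? hv
    obtain ⟨y, hy⟩ := exists_getElem? hw
    rw [pos_eq hx, Prod.mk.injEq] at h1
    rw [pos_eq hy, Prod.mk.injEq] at h2
    obtain ⟨rfl, h1⟩ := h1
    obtain ⟨rfl, h2⟩ := h2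
    have h3 := h.anti (w + 1) hi.le
    rw [rowCount_succ hy y, if_pos rfl] at h3
    have h4 := lt_of_rowCount_lt (l := l) (i := x) (v := v) (w := w + 1) (by omega)
    have h5 : v ≠ w := by
      rintro rfl
      rw [hx] at hy
      cases hy
      exact lt_irrefl _ hi
    omega

/-- A tableau is the one with row word `l` as soon as its entry `v + 1` is in the cell `pos l mu v`
for all `v`. -/
theorem eq_tableau {n : ℕ} {l : List ℕ} {mu : YoungDiagram} (h : IsLattice n l mu) {T : SkewSYT n}
    (hin : T.inner = mu) (hT : ∀ v < l.length, T.entry (pos l mu v) = v + 1) : T = tableau h := by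
  have hcells : T.outer.cells \ T.inner.cells = (Finset.range l.length).image (pos l mu) := by
    ext c
    rw [Finset.mem_image]
    constructor
    · intro hc
      have h1 := T.entry_bijOn.mapsTo (Finset.mem_coe.2 hc)
      rw [Set.mem_Icc] at h1
      have hn := h.length_eq
      have hv : T.entry c - 1 < l.length := by omega
      refine ⟨T.entry c - 1, Finset.mem_range.2 hv, ?_⟩
      have h2 := hT _ hv
      refine T.entry_bijOn.injOn ?_ (Finset.mem_coe.2 hc) (by omega)
      by_contra h3
      rw [T.entry_zero _ fun h => h3 (Finset.mem_coe.2 h)] at h2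
      omega
    · rintro ⟨v, hv, rfl⟩
      by_contra h3
      have h2 := hT v (Finset.mem_range.1 hv)
      rw [T.entry_zero _ h3] at h2
      omega
  refine SkewSYT.ext hin ?_ ?_
  · ext c
    have h1 : T.outer.cells = T.inner.cells ∪ (T.outer.cells \ T.inner.cells) := by
      rw [Finset.union_sdiff_of_subset (YoungDiagram.cells_subset_iff.2 T.inner_le)]
    rw [h1, hcells, hin]
    rfl
  · refine eq_filling hT fun c hc => T.entry_zero c fun h => ?_
    rw [hcells, Finset.mem_image] at h
    obtain ⟨v, hv, h⟩ := h
    exact hc v (Finset.mem_range.1 hv) h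

/-- A tableau determines its row word. -/
theorem word_eq_of_tableau_eq {n : ℕ} {l l' : List ℕ} {mu : YoungDiagram} {h : IsLattice n l mu}
    {h' : IsLattice n l' mu} (heq : tableau h = tableau h') : l = l' := by
  have hlen : l.length = l'.length := h.length_eq.trans h'.length_eq.symm
  have hpos : ∀ v < l.length, pos l mu v = pos l' mu v := by
    intro v hv
    have h1 : filling l mu = filling l' mu := congrArg SkewSYT.entry heq
    have h2 := filling_pos (l := l) (mu := mu) hv
    by_contra hne
    rw [h1] at h2
    have h3 : pos l mu v ∈ ((outerShape h').cells \ mu.cells) := by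
      by_contra h3
      have := (tableau h').entry_zero _ h3
      have h4 : filling l' mu (pos l mu v) = 0 := this
      omega
    rw [outerShape_sdiff, Finset.mem_image] at h3
    obtain ⟨w, hw, h3⟩ := h3
    rw [Finset.mem_range] at hw
    rw [← h3, filling_pos hw] at h2
    have : w = v := by omega
    exact hne (this ▸ h3.symm)
  refine List.ext_getElem? fun v => ?_
  by_cases hv : v < l.length
  · obtain ⟨x, hx⟩ := exists_getElem? hv
    obtain ⟨y, hy⟩ := exists_getElem? (hlen ▸ hv)
    have := hpos v hv
    rw [pos_eq hx, pos_eq hy, Prod.mk.injEq] at this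
    rw [hx, hy, this.1]
  · rw [List.getElem?_eq_none (by omega), List.getElem?_eq_none (by omega)]

theorem descents_tableau {n : ℕ} {l : List ℕ} {mu : YoungDiagram} (h : IsLattice n l mu) :
    (tableau h).descents = descents l := by
  have hcells : (tableau h).cells = (Finset.range l.length).image (pos l mu) := outerShape_sdiff h
  ext i
  constructor
  · rintro ⟨c, hc, d, hd, hci, hdi, hcd⟩
    rw [hcells, Finset.mem_image] at hc hd
    obtain ⟨v, hv, rfl⟩ := hc
    obtain ⟨w, hw, rfl⟩ := hd
    rw [Finset.mem_range] at hv hw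
    have h1 : v + 1 = i := (filling_pos hv).symm.trans hci
    have h2 : w + 1 = i + 1 := (filling_pos hw).symm.trans hdi
    obtain rfl : w = i := by omega
    subst h1
    obtain ⟨x, hx⟩ := exists_getElem? hv
    obtain ⟨y, hy⟩ := exists_getElem? hw
    rw [pos_eq hx, pos_eq hy] at hcd
    exact ⟨by omega, x, y, by simpa using hx, hy, hcd⟩
  · rintro ⟨hi, x, y, hx, hy, hxy⟩
    refine ⟨pos l mu (i - 1), ?_, pos l mu i, ?_, ?_, ?_, ?_⟩
    · rw [hcells]
      exact Finset.mem_image_of_mem _ (Finset.mem_range.2 (lt_length hx))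
    · rw [hcells]
      exact Finset.mem_image_of_mem _ (Finset.mem_range.2 (lt_length hy))
    · exact (filling_pos (lt_length hx)).trans (by omega)
    · exact filling_pos (lt_length hy)
    · rw [pos_eq hx, pos_eq hy]
      exact hxy

/-! ### The row word of a straight tableau -/

theorem rowLen_bot (i : ℕ) : (⊥ : YoungDiagram).rowLen i = 0 := by
  by_contra h
  exact YoungDiagram.notMem_bot (i, 0) (YoungDiagram.mem_iff_lt_rowLen.2 (Nat.pos_of_ne_zero h))

/-- Every straight tableau with at most three rows has a dominant row word. -/
theorem exists_word_of_isStraight {n : ℕ} (T : SkewSYT n) (hT : T.IsStraight)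
    (hr : T.outer.colLen 0 ≤ 3) :
    ∃ (l : List ℕ) (h : IsLattice n l ⊥), IsWord n l ∧ T = tableau h := by
  have hbij := T.entry_bijOn
  have hrow := T.row_strict
  have hcol := T.col_strict
  rw [hT] at hbij hrow hcol
  simp only [YoungDiagram.cells_bot, Finset.sdiff_empty] at hbij hrow hcol
  -- The cell that holds the entry `v + 1`.
  have hex : ∀ v, ∃ c, v < n → c ∈ T.outer.cells ∧ T.entry c = v + 1 := by
    intro v
    by_cases hv : v < n
    · obtain ⟨c, hc, h⟩ := hbij.surjOn (show v + 1 ∈ Set.Icc 1 n from ⟨by omega, by omega⟩)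
      exact ⟨c, fun _ => ⟨hc, h⟩⟩
    · exact ⟨default, fun h => absurd h hv⟩
  choose c hc using hex
  have hcell : ∀ d ∈ T.outer.cells, T.entry d - 1 < n ∧ c (T.entry d - 1) = d := by
    intro d hd
    have h1 := hbij.mapsTo (Finset.mem_coe.2 hd)
    rw [Set.mem_Icc] at h1
    have h2 : T.entry d - 1 < n := by omega
    obtain ⟨h3, h4⟩ := hc _ h2
    exact ⟨h2, hbij.injOn h3 hd (by omega)⟩
  set l : List ℕ := List.ofFn fun v : Fin n => (c v).1 with hl
  have hlen : l.length = n := by simp [hl]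
  have hget : ∀ v < n, l[v]? = some (c v).1 := by
    intro v hv
    rw [List.getElem?_eq_getElem (by omega)]
    simp [hl]
  -- The entries of a row are in increasing order, so that the column of `v + 1` is the number of
  -- smaller entries in its row.
  have hcount : ∀ t ≤ n, ∀ i j, (i, j) ∈ T.outer.cells →
      (j < rowCount l i t ↔ T.entry (i, j) ≤ t) := by
    intro t
    induction t with
    | zero =>
      intro _ i j hij
      have h1 := hbij.mapsTo (Finset.mem_coe.2 hij)
      rw [Set.mem_Icc] at h1
      simp
      omega
    | succ t ih =>
      intro ht i j hij
      rw [rowCount_succ (hget t (by omega))]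
      obtain ⟨hct, hce⟩ := hc t (by omega)
      have ih := ih (by omega)
      by_cases hi : (c t).1 = i
      · rw [if_pos hi]
        rcases ht' : c t with ⟨i', j'⟩
        rw [ht'] at hct hce hi
        obtain rfl : i' = i := hi
        have hj' : rowCount l i' t = j' := by
          apply le_antisymm
          · by_contra hlt
            have := (ih i' j' hct).1 (by omega)
            omega
          · by_contra hlt
            have hm : (i', rowCount l i' t) ∈ T.outer.cells :=
              T.outer.up_left_mem le_rfl (by omega) hct
            have h1 := hrow i' (rowCount l i' t) j' (by omega) hm hct
            have h2 := (ih i' _ hm).2 (by omega)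
            omega
        rw [hj']
        rcases lt_trichotomy j j' with hlt | rfl | hlt
        · have h1 := hrow i' j j' hlt hij hct
          constructor <;> intro <;> omega
        · constructor <;> intro <;> omega
        · have h1 := hrow i' j' j hlt hct hij
          constructor <;> intro <;> omega
      · rw [if_neg hi, add_zero, ih i j hij]
        have hne : T.entry (i, j) ≠ t + 1 := by
          intro h
          have := (hcell _ hij).2
          rw [h, Nat.add_sub_cancel] at this
          exact hi (by rw [this])
        omega
  have hcol0 : ∀ i j, (i, j) ∈ T.outer.cells → i < 3 := by
    intro i j hij
    have h1 : (i, 0) ∈ T.outer := T.outer.up_left_mem le_rfl (Nat.zero_le _) hij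
    have h2 := YoungDiagram.mem_iff_lt_colLen.1 h1
    omega
  have hcv : ∀ v < n, (c v).2 = rowCount l (c v).1 v := by
    intro v hv
    obtain ⟨h1, h2⟩ := hc v hv
    have h3 := hcount v (by omega) (c v).1 (c v).2 h1
    have h4 := hcount (v + 1) (by omega) (c v).1 (c v).2 h1
    rw [rowCount_succ (hget v hv), if_pos rfl] at h4
    rw [Prod.mk.eta] at h3 h4
    omega
  have hpos : ∀ v < n, pos l ⊥ v = c v := by
    intro v hv
    rw [pos_eq (hget v hv), rowLen_bot, zero_add, ← hcv v hv]
  have hlat : IsLattice n l ⊥ := by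
    refine ⟨hlen, fun i t => ?_⟩
    rw [rowLen_bot, rowLen_bot, zero_add, zero_add]
    by_contra hlt
    obtain ⟨v, hvt, hv, hvc⟩ := exists_rowCount_eq (l := l) (i := i + 1) (t := t)
      (m := rowCount l i t) (by omega)
    have hvn : v < n := hlen ▸ lt_length hv
    have h1 : (c v).1 = i + 1 := by
      have := hget v hvn
      rw [hv] at this
      exact (Option.some.inj this).symm
    obtain ⟨h2, h3⟩ := hc v hvn
    have h4 : c v = (i + 1, rowCount l i t) := by
      rw [← hvc, ← h1]
      exact Prod.ext rfl (hcv v hvn)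
    rw [h4] at h2 h3
    have h5 : (i, rowCount l i t) ∈ T.outer.cells := T.outer.up_left_mem (Nat.le_succ i) le_rfl h2
    have h6 := hcol i (i + 1) _ (Nat.lt_succ_self i) h5 h2
    have h7 := (hcount v (by omega) i _ h5).2 (by omega)
    have h8 := rowCount_mono l i hvt.le
    omega
  refine ⟨l, hlat, ⟨hlen, fun x hx => ?_⟩, eq_tableau hlat hT fun v hv => ?_⟩
  · obtain ⟨v, hv⟩ := List.mem_iff_getElem?.1 hx
    have hvn : v < n := hlen ▸ lt_length hv
    rw [hget v hvn] at hv
    cases hv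
    exact hcol0 _ _ (hc v hvn).1
  · rw [hpos v (hlen ▸ hv)]
    exact (hc v (hlen ▸ hv)).2

end RowWord

/-! ### Jeu de taquin slides -/

namespace RowWord

open SkewSYT

theorem holeMove_rightUnique (lam : YoungDiagram) : Relator.RightUnique (HoleMove lam) := by
  rintro _ _ _ (⟨f, i, j, hmem, hlt⟩ | ⟨f, i, j, hmem, hlt⟩)
    (⟨_, _, _, hmem', hlt'⟩ | ⟨_, _, _, hmem', hlt'⟩)
  · rfl
  · exact absurd (hlt hmem') (hlt' hmem).not_gt
  · exact absurd (hlt hmem') (hlt' hmem).not_gt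
  · rfl

theorem eq_of_holeMoves_of_isCorner {lam : YoungDiagram} {f g : ℕ × ℕ → ℕ} {h h' : ℕ × ℕ}
    (hh : IsCorner lam h) (H : Relation.ReflTransGen (HoleMove lam) (f, h) (g, h')) :
    (f, h) = (g, h') := by
  rcases Relation.ReflTransGen.cases_head H with H | ⟨x, H, -⟩
  · exact H
  · cases H with
    | right f i j hmem hlt => exact absurd hmem hh.2.1
    | down f i j hmem hlt => exact absurd hmem hh.2.2

/-- The hole of a jeu de taquin slide ends at a unique corner, with a unique filling. -/
theorem holeMoves_unique {lam : YoungDiagram} {f g g' : ℕ × ℕ → ℕ} {c h h' : ℕ × ℕ}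
    (H : Relation.ReflTransGen (HoleMove lam) (f, c) (g, h)) (hh : IsCorner lam h)
    (H' : Relation.ReflTransGen (HoleMove lam) (f, c) (g', h')) (hh' : IsCorner lam h') :
    g = g' ∧ h = h' := by
  rw [← Prod.mk.injEq]
  rcases Relation.ReflTransGen.total_of_right_unique (holeMove_rightUnique lam) H H' with h1 | h1
  · exact eq_of_holeMoves_of_isCorner hh h1
  · exact (eq_of_holeMoves_of_isCorner hh' h1).symm

/-- The filling `f` after the hole has moved within row `i` from column `a` to column `b`. -/
def shiftRow (f : ℕ × ℕ → ℕ) (i a b : ℕ) (c : ℕ × ℕ) : ℕ :=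
  if c.1 = i ∧ a ≤ c.2 ∧ c.2 < b then f (i, c.2 + 1) else if c = (i, b) then 0 else f c

theorem shiftRow_of_row_ne {f : ℕ × ℕ → ℕ} {i a b i' j : ℕ} (h : i' ≠ i) :
    shiftRow f i a b (i', j) = f (i', j) := by
  simp [shiftRow, h]

theorem shiftRow_of_mem {f : ℕ × ℕ → ℕ} {i a b j : ℕ} (h1 : a ≤ j) (h2 : j < b) :
    shiftRow f i a b (i, j) = f (i, j + 1) := by
  simp [shiftRow, h1, h2]

theorem shiftRow_hole {f : ℕ × ℕ → ℕ} {i a b : ℕ} : shiftRow f i a b (i, b) = 0 := by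
  simp [shiftRow]

theorem shiftRow_of_lt {f : ℕ × ℕ → ℕ} {i a b j : ℕ} (h : j < a) (hab : a ≤ b) :
    shiftRow f i a b (i, j) = f (i, j) := by
  have h1 : ¬ a ≤ j := by omega
  have h2 : j ≠ b := by omega
  simp [shiftRow, h1, h2]

theorem shiftRow_of_gt {f : ℕ × ℕ → ℕ} {i a b j : ℕ} (h : b < j) :
    shiftRow f i a b (i, j) = f (i, j) := by
  have h1 : ¬ j < b := by omega
  have h2 : j ≠ b := by omega
  simp [shiftRow, h1, h2]

theorem holeMoves_row {lam : YoungDiagram} {f : ℕ × ℕ → ℕ} {i a b : ℕ} (hf : f (i, a) = 0)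
    (hab : a ≤ b)
    (h : ∀ k, a ≤ k → k < b →
      (i, k + 1) ∈ lam ∧ ((i + 1, k) ∈ lam → f (i, k + 1) < f (i + 1, k))) :
    Relation.ReflTransGen (HoleMove lam) (f, (i, a)) (shiftRow f i a b, (i, b)) := by
  induction b, hab using Nat.le_induction with
  | base =>
    have : shiftRow f i a a = f := by
      funext ⟨i', j⟩
      by_cases hi : i' = i
      · subst hi
        rcases lt_trichotomy j a with hj | rfl | hj
        · exact shiftRow_of_lt hj le_rfl
        · rw [shiftRow_hole, hf]
        · exact shiftRow_of_gt hj
      · exact shiftRow_of_row_ne hi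
    rw [this]
  | succ b hab ih =>
    refine (ih fun k h1 h2 => h k h1 (by omega)).tail ?_
    obtain ⟨h1, h2⟩ := h b hab (by omega)
    have h3 : shiftRow f i a b (i, b + 1) = f (i, b + 1) := shiftRow_of_gt (by omega)
    have h4 := HoleMove.right (lam := lam) (shiftRow f i a b) i b h1 fun h5 => by
      rw [h3, shiftRow_of_row_ne (by omega)]
      exact h2 h5
    convert h4 using 2
    funext ⟨i', j⟩
    by_cases hi : i' = i
    · subst hi
      rcases lt_trichotomy j (b + 1) with hj | rfl | hj
      · rw [Function.update_of_ne (by simp; omega)]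
        by_cases hjb : j = b
        · subst hjb
          rw [Function.update_self, h3, shiftRow_of_mem hab (by omega)]
        · rw [Function.update_of_ne (by simp; omega)]
          by_cases hja : a ≤ j
          · rw [shiftRow_of_mem hja hj, shiftRow_of_mem hja (by omega)]
          · rw [shiftRow_of_lt (by omega) (by omega), shiftRow_of_lt (by omega) hab]
      · rw [shiftRow_hole, Function.update_self]
      · rw [shiftRow_of_gt hj, Function.update_of_ne (by simp; omega),
          Function.update_of_ne (by simp; omega), shiftRow_of_gt (by omega)]
    · rw [shiftRow_of_row_ne hi, Function.update_of_ne (by simp [hi]),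
        Function.update_of_ne (by simp [hi]), shiftRow_of_row_ne hi]

/-- `mu'` is obtained from `mu` by shortening row `r` by one cell. -/
structure IsShortened (mu mu' : YoungDiagram) (r : ℕ) : Prop where
  row : mu.rowLen r = mu'.rowLen r + 1
  row_ne : ∀ i, i ≠ r → mu.rowLen i = mu'.rowLen i

theorem isShortened_of_erase {mu mu' : YoungDiagram} {c : ℕ × ℕ} (hc : IsCorner mu c)
    (h : mu'.cells = mu.cells.erase c) : IsShortened mu mu' c.1 ∧ c.2 = mu'.rowLen c.1 := by
  obtain ⟨r, a⟩ := c
  have hmem : ∀ i j, j < mu'.rowLen i ↔ ¬ (i = r ∧ j = a) ∧ j < mu.rowLen i := by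
    intro i j
    rw [← YoungDiagram.mem_iff_lt_rowLen, ← YoungDiagram.mem_iff_lt_rowLen,
      ← YoungDiagram.mem_cells, h, Finset.mem_erase, YoungDiagram.mem_cells, ne_eq, Prod.mk.injEq]
  obtain ⟨h1, h2, -⟩ := hc
  rw [YoungDiagram.mem_iff_lt_rowLen] at h1 h2
  have h3 : mu'.rowLen r = a := by
    apply le_antisymm
    · by_contra hlt
      have := (hmem r a).1 (by omega)
      simp at this
    · by_contra hlt
      have h4 := hmem r (mu'.rowLen r)
      omega
  refine ⟨⟨by simp only at h1 h2 ⊢; omega, fun i hi => ?_⟩, h3.symm⟩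
  have h4 := hmem i (mu.rowLen i)
  have h5 := hmem i (mu'.rowLen i)
  simp only at hi
  omega

/-- The diagram without the corner `c`. -/
def eraseCorner {mu : YoungDiagram} {c : ℕ × ℕ} (hc : IsCorner mu c) : YoungDiagram where
  cells := mu.cells.erase c
  isLowerSet := by
    rintro ⟨i, j⟩ ⟨i', j'⟩ hle hd
    obtain ⟨hi, hj⟩ := Prod.mk_le_mk.1 hle
    rw [Finset.mem_coe, Finset.mem_erase, YoungDiagram.mem_cells] at hd ⊢
    refine ⟨?_, mu.up_left_mem hi hj hd.2⟩
    rintro rfl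
    obtain ⟨-, h2, h3⟩ := hc
    rcases Nat.lt_or_ge i' i with h | h
    · exact h3 (mu.up_left_mem h hj hd.2)
    · rcases Nat.lt_or_ge j' j with h' | h'
      · exact h2 (mu.up_left_mem hi h' hd.2)
      · exact hd.1 (by rw [le_antisymm hi h, le_antisymm hj h'])

/-- A cell of the tableau outside the inner shape, together with its entry. -/
theorem exists_entry {n : ℕ} {l : List ℕ} {mu : YoungDiagram} (h : IsLattice n l mu) {i j : ℕ}
    (h1 : mu.rowLen i ≤ j) (h2 : (i, j) ∈ outerShape h) :
    ∃ v, l[v]? = some i ∧ mu.rowLen i + rowCount l i v = j ∧ filling l mu (i, j) = v + 1 := by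
  obtain ⟨v, hv, hx, hp⟩ := exists_pos_eq h1 ((mem_outerShape h).1 h2)
  rw [pos_eq hx, Prod.mk.injEq] at hp
  exact ⟨v, hx, hp.2, filling_of_getElem? hx hp.2⟩

/-- A slide that starts in row `r` and ends with the filling of the word `l'` and the inner
shape `mu'`. -/
def SlidesTo (n r : ℕ) {l l' : List ℕ} {mu mu' : YoungDiagram} (h : IsLattice n l mu)
    (h' : IsLattice n l' mu') : Prop :=
  ∃ e : ℕ × ℕ, Relation.ReflTransGen (HoleMove (outerShape h)) (filling l mu, (r, mu'.rowLen r))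
      (filling l' mu', e) ∧ IsCorner (outerShape h) e ∧
    (outerShape h').cells = (outerShape h).cells.erase e

/-- If the word is compatible with the shortened inner shape, the hole stays in its row, and the
word does not change. -/
theorem slidesTo_of_isLattice {n r : ℕ} {l : List ℕ} {mu mu' : YoungDiagram}
    (h : IsLattice n l mu) (h' : IsLattice n l mu') (hs : IsShortened mu mu' r) :
    SlidesTo n r h h' := by
  have hrow := hs.row
  have hrow1 := hs.row_ne (r + 1) (by omega)
  have hanti := mu'.rowLen_anti r (r + 1) (by omega)
  set a := mu'.rowLen r with ha
  refine ⟨(r, a + rowCount l r l.length), ?_, ⟨?_, ?_, ?_⟩, ?_⟩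
  · convert holeMoves_row (lam := outerShape h) (f := filling l mu) (i := r) (a := a)
      (b := a + rowCount l r l.length) (filling_eq_zero_of_lt (by omega)) (by omega) ?_ using 2
    · refine (eq_filling (fun v hv => ?_) fun c hc => ?_).symm
      · obtain ⟨x, hx⟩ := exists_getElem? hv
        rw [pos_eq hx]
        by_cases hxr : x = r
        · subst hxr
          have := rowCount_lt hx hv
          rw [shiftRow_of_mem (by omega) (by omega)]
          exact filling_of_getElem? hx (by omega)
        · rw [shiftRow_of_row_ne hxr]
          exact filling_of_getElem? hx (by rw [hs.row_ne x hxr])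
      · obtain ⟨i, j⟩ := c
        have hout : j < mu'.rowLen i ∨ mu'.rowLen i + rowCount l i l.length ≤ j := by
          by_contra hcon
          obtain ⟨v, hv, -, hp⟩ := exists_pos_eq (l := l) (mu := mu') (i := i) (j := j)
            (by omega) (by omega)
          exact hc v hv hp
        by_cases hi : i = r
        · subst hi
          rcases hout with hj | hj
          · rw [shiftRow_of_lt hj (by omega)]
            exact filling_eq_zero_of_lt (by omega)
          · rcases Nat.eq_or_lt_of_le hj with hj | hj
            · rw [← hj, shiftRow_hole]
            · rw [shiftRow_of_gt hj]
              exact filling_eq_zero_of_ge (by omega)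
        · rw [shiftRow_of_row_ne hi]
          rw [← hs.row_ne i hi] at hout
          exact hout.elim filling_eq_zero_of_lt filling_eq_zero_of_ge
    · intro k h1 h2
      refine ⟨(mem_outerShape h).2 (by omega), fun h3 => ?_⟩
      obtain ⟨v, hv, hvc, hve⟩ := exists_entry h (i := r) (j := k + 1) (by omega)
        ((mem_outerShape h).2 (by omega))
      obtain ⟨u, hu, huc, hue⟩ := exists_entry h (by omega) h3
      rw [hve, hue]
      have h4 := h'.ballot r (u + 1)
      rw [rowCount_succ hu (r + 1), if_pos rfl] at h4
      have h5 := lt_of_rowCount_lt (l := l) (i := r) (v := v) (w := u + 1) (by omega)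
      have h6 : v ≠ u := by
        rintro rfl
        rw [hu] at hv
        simp at hv
      omega
  · exact (mem_outerShape h).2 (by omega)
  · rw [mem_outerShape h]
    simp only
    omega
  · rw [mem_outerShape h]
    have := h'.ballot r l.length
    simp only
    omega
  · ext ⟨i, j⟩
    rw [Finset.mem_erase, YoungDiagram.mem_cells, YoungDiagram.mem_cells, mem_outerShape,
      mem_outerShape, ne_eq, Prod.mk.injEq]
    by_cases hi : i = r
    · subst hi
      omega
    · rw [hs.row_ne i hi]
      tauto

/-- If the hole leaves row `r`, it does so at the letter changed by the `r`th raising operator; if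
the raised word is compatible with the shortened inner shape, the hole then stays in
row `r + 1`. -/
theorem slidesTo_of_raiseAt {n r t : ℕ} {l l' : List ℕ} {mu mu' : YoungDiagram}
    (h : IsLattice n l mu) (h' : IsLattice n l' mu') (hs : IsShortened mu mu' r)
    (hr : RaiseAt r t l l')
    (hex : excess l r (t + 1) = mu.rowLen r - mu.rowLen (r + 1)) : SlidesTo n r h h' := by
  have hrow := hs.row
  have hrow1 := hs.row_ne (r + 1) (by omega)
  have hrow2 := hs.row_ne (r + 1 + 1) (by omega)
  have hanti := mu'.rowLen_anti r (r + 1) (by omega)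
  have hanti' := mu'.rowLen_anti (r + 1) (r + 1 + 1) (by omega)
  have hlen := hr.length_eq
  have ht := lt_length hr.letter
  have hstep := hr.excess_succ
  set a := mu'.rowLen r with ha
  set b := mu'.rowLen (r + 1) with hb
  -- The hole moves down in the column of the letter `t`.
  have hj : a + rowCount l r t = b + rowCount l (r + 1) t := by
    rw [hex] at hstep
    unfold excess at hstep
    omega
  set j₀ := a + rowCount l r t with hj₀
  have hcr := rowCount_mono l r ht.le
  have hcr1 := rowCount_lt hr.letter ht
  set e := b + rowCount l (r + 1) l.length - 1 with he
  have hft : filling l mu (r + 1, j₀) = t + 1 := filling_of_getElem? hr.letter (by omega)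
  have hmove1 := holeMoves_row (lam := outerShape h) (f := filling l mu) (i := r) (a := a)
    (b := j₀) (filling_eq_zero_of_lt (by omega)) (by omega) fun k h1 h2 => by
      refine ⟨(mem_outerShape h).2 (by omega), fun h3 => ?_⟩
      obtain ⟨v, hv, hvc, hve⟩ := exists_entry h (i := r) (j := k + 1) (by omega)
        ((mem_outerShape h).2 (by omega))
      obtain ⟨u, hu, huc, hue⟩ := exists_entry h (by omega) h3
      rw [hve, hue]
      have h6 : v ≠ u := by
        rintro rfl
        rw [hu] at hv
        simp at hv
      by_contra hlt
      have hvt := lt_of_rowCount_lt (l := l) (i := r) (v := v) (w := t) (by omega)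
      have h4 := hr.first (u + 1) (by omega)
      rw [hex] at h4
      unfold excess at h4
      rw [rowCount_succ hu (r + 1), if_pos rfl] at h4
      have h5 := lt_of_rowCount_lt (l := l) (i := r) (v := v) (w := u + 1) (by omega)
      omega
  set g := shiftRow (filling l mu) r a j₀ with hg
  have hg1 : ∀ j, g (r + 1, j) = filling l mu (r + 1, j) := fun j => shiftRow_of_row_ne (by omega)
  have hmove2 := HoleMove.down (lam := outerShape h) g r j₀ ((mem_outerShape h).2 (by omega))
    fun h3 => by
      obtain ⟨v, hv, hvc, hve⟩ := exists_entry h (by omega) h3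
      rw [hg1, hft, hg, shiftRow_of_gt (by omega), hve]
      have h4 : ¬ v < t := fun hlt => by
        have := rowCount_lt hv hlt
        omega
      have h5 : v ≠ t := by
        rintro rfl
        rw [hr.letter] at hv
        simp at hv
      omega
  set g' := Function.update (Function.update g (r, j₀) (g (r + 1, j₀))) (r + 1, j₀) 0 with hg'
  have hg'0 : g' (r + 1, j₀) = 0 := Function.update_self _ _ _
  have hg'1 : g' (r, j₀) = t + 1 := by
    rw [hg', Function.update_of_ne (by simp), Function.update_self, hg1, hft]
  have hg'2 : ∀ c, c ≠ (r, j₀) → c ≠ (r + 1, j₀) → g' c = g c := fun c h1 h2 => by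
    rw [hg', Function.update_of_ne h2, Function.update_of_ne h1]
  have hg'3 : ∀ i j, i ≠ r → (i, j) ≠ (r + 1, j₀) → g' (i, j) = filling l mu (i, j) :=
    fun i j h1 h2 => by rw [hg'2 _ (by simp [h1]) h2, hg, shiftRow_of_row_ne h1]
  have hmove3 := holeMoves_row (lam := outerShape h) (f := g') (i := r + 1) (a := j₀)
    (b := e) hg'0 (by omega) fun k h1 h2 => by
      refine ⟨(mem_outerShape h).2 (by omega), fun h3 => ?_⟩
      obtain ⟨v, hv, hvc, hve⟩ := exists_entry h (i := r + 1) (j := k + 1) (by omega)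
        ((mem_outerShape h).2 (by omega))
      obtain ⟨u, hu, huc, hue⟩ := exists_entry h (by omega) h3
      rw [hg'3 _ _ (by omega) (by simp; omega), hg'3 _ _ (by omega) (by simp), hve, hue]
      have h6 : v ≠ u := by
        rintro rfl
        rw [hu] at hv
        simp at hv
      have h4 := h'.ballot (r + 1) (u + 1)
      have h5 := hr.rowCount_row_succ (u + 1)
      rw [hr.rowCount_of_ne (by omega) (by omega), rowCount_succ hu (r + 1 + 1), if_pos rfl] at h4
      by_cases hut : t < u + 1
      · rw [if_pos hut] at h5
        have h7 := lt_of_rowCount_lt (l := l) (i := r + 1) (v := v) (w := u + 1) (by omega)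
        omega
      · have h7 := rowCount_mono l (r + 1) (show u + 1 ≤ t by omega)
        rw [if_neg hut] at h5
        omega
  have hcount_r := hr.rowCount_row l.length
  have hcount_r1 := hr.rowCount_row_succ l.length
  rw [if_pos ht] at hcount_r hcount_r1
  refine ⟨(r + 1, e), ?_, ⟨?_, ?_, ?_⟩, ?_⟩
  · convert (hmove1.tail hmove2).trans hmove3 using 2
    refine (eq_filling (fun v hv => ?_) fun c hc => ?_).symm
    · rw [hlen] at hv
      by_cases hvt : v = t
      · subst hvt
        have hx : l'[v]? = some r := by rw [hr.eq_set]; simp [ht]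
        have h1 := hr.rowCount_row v
        rw [if_neg (by omega), add_zero] at h1
        rw [pos_eq hx, h1, shiftRow_of_row_ne (by omega), hg'1]
      · obtain ⟨x, hx⟩ := exists_getElem? hv
        have hx' : l'[v]? = some x := by
          rw [hr.eq_set, List.getElem?_set, if_neg (Ne.symm hvt), hx]
        rw [pos_eq hx']
        by_cases hxr : x = r
        · subst hxr
          rw [shiftRow_of_row_ne (by omega), hr.rowCount_row v]
          rcases Nat.lt_or_gt_of_ne hvt with hlt | hlt
          · have h1 := rowCount_lt hx hlt
            rw [if_neg (by omega), add_zero, hg'2 _ (by simp; omega) (by simp), hg,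
              shiftRow_of_mem (by omega) (by omega)]
            exact filling_of_getElem? hx (by omega)
          · have h1 := rowCount_mono l x hlt.le
            rw [if_pos hlt, hg'2 _ (by simp; omega) (by simp), hg, shiftRow_of_gt (by omega)]
            exact filling_of_getElem? hx (by omega)
        · by_cases hxr1 : x = r + 1
          · subst hxr1
            have h0 := hr.rowCount_row_succ v
            rcases Nat.lt_or_gt_of_ne hvt with hlt | hlt
            · have h1 := rowCount_lt hx hlt
              rw [if_neg (by omega), add_zero] at h0
              rw [h0, shiftRow_of_lt (by omega) (by omega), hg'3 _ _ (by omega) (by simp; omega)]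
              exact filling_of_getElem? hx (by omega)
            · have h1 := rowCount_lt hr.letter hlt
              have h2 := rowCount_lt hx hv
              rw [if_pos hlt] at h0
              rw [shiftRow_of_mem (by omega) (by omega), hg'3 _ _ (by omega) (by simp; omega)]
              exact filling_of_getElem? hx (by omega)
          · rw [shiftRow_of_row_ne hxr1, hg'3 _ _ hxr (by simp [hxr1]),
              hr.rowCount_of_ne hxr hxr1]
            exact filling_of_getElem? hx (by rw [hs.row_ne x hxr])
    · obtain ⟨i, j⟩ := c
      have hout : j < mu'.rowLen i ∨ mu'.rowLen i + rowCount l' i l.length ≤ j := by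
        by_contra hcon
        obtain ⟨v, hv, -, hp⟩ := exists_pos_eq (l := l') (mu := mu') (i := i) (j := j)
          (by omega) (by rw [hlen]; omega)
        exact hc v hv hp
      by_cases hi : i = r
      · subst hi
        rw [shiftRow_of_row_ne (by omega)]
        rcases hout with hj' | hj'
        · rw [hg'2 _ (by simp; omega) (by simp), hg, shiftRow_of_lt (by omega) (by omega)]
          exact filling_eq_zero_of_lt (by omega)
        · rw [hg'2 _ (by simp; omega) (by simp), hg, shiftRow_of_gt (by omega)]
          exact filling_eq_zero_of_ge (by omega)
      · by_cases hi1 : i = r + 1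
        · subst hi1
          rcases hout with hj' | hj'
          · rw [shiftRow_of_lt (by omega) (by omega), hg'3 _ _ (by omega) (by simp; omega)]
            exact filling_eq_zero_of_lt (by omega)
          · rcases Nat.eq_or_lt_of_le (show e ≤ j by omega) with hj' | hj'
            · rw [← hj', shiftRow_hole]
            · rw [shiftRow_of_gt hj', hg'3 _ _ (by omega) (by simp; omega)]
              exact filling_eq_zero_of_ge (by omega)
        · rw [shiftRow_of_row_ne hi1, hg'3 _ _ hi (by simp [hi1])]
          rw [← hs.row_ne i hi, hr.rowCount_of_ne hi hi1] at hout
          exact hout.elim filling_eq_zero_of_lt filling_eq_zero_of_ge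
  · exact (mem_outerShape h).2 (by omega)
  · rw [mem_outerShape h]
    simp only
    omega
  · rw [mem_outerShape h]
    have h1 := h'.ballot (r + 1) l.length
    rw [hr.rowCount_of_ne (by omega) (by omega)] at h1
    simp only
    omega
  · ext ⟨i, j⟩
    rw [Finset.mem_erase, YoungDiagram.mem_cells, YoungDiagram.mem_cells, mem_outerShape,
      mem_outerShape, ne_eq, Prod.mk.injEq, hlen]
    by_cases hi : i = r
    · subst hi
      omega
    · by_cases hi1 : i = r + 1
      · subst hi1
        omega
      · rw [hs.row_ne i hi, hr.rowCount_of_ne hi hi1]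
        tauto

/-- A slide on the tableau of a tame word, starting in one of the first two rows, applies at most
one raising operator to the word: for a hole that has moved from the first row to the second,
tameness prevents a further move to the third row. -/
theorem exists_slidesTo {n r : ℕ} {l : List ℕ} {mu mu' : YoungDiagram} (h : IsLattice n l mu)
    (hw : IsWord n l) (hl : IsTame l) (hs : IsShortened mu mu' r) (hr : r < 2) :
    ∃ (l' : List ℕ) (h' : IsLattice n l' mu'), (l = l' ∨ Step l l') ∧ SlidesTo n r h h' := by
  have hrow := hs.row
  have hrow1 := hs.row_ne (r + 1) (by omega)
  have hanti := mu'.rowLen_anti r (r + 1) (by omega)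
  by_cases hb : ∀ t, mu'.rowLen (r + 1) + rowCount l (r + 1) t ≤ mu'.rowLen r + rowCount l r t
  · have h' : IsLattice n l mu' := by
      refine ⟨h.length_eq, fun i t => ?_⟩
      by_cases hi : i = r
      · subst hi
        exact hb t
      · have h1 := h.ballot i t
        rw [hs.row_ne i hi] at h1
        by_cases hi1 : i + 1 = r
        · rw [hi1] at h1 ⊢
          omega
        · rw [hs.row_ne _ hi1] at h1
          exact h1
    exact ⟨l, h', .inl rfl, slidesTo_of_isLattice h h' hs⟩
  · push Not at hb
    obtain ⟨s, hs'⟩ := hb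
    obtain ⟨t, l', hra⟩ := exists_raise (l := l) (r := r) (s := s) (by unfold excess; omega)
    have hex : excess l r (t + 1) = mu.rowLen r - mu.rowLen (r + 1) := by
      have h1 := hra.max s
      have h2 := h.ballot r (t + 1)
      unfold excess at h1 ⊢
      omega
    have hstep : Step l l' := by
      refine ⟨hl, ?_⟩
      interval_cases r
      · exact .inl ⟨t, hra⟩
      · exact .inr ⟨t, hra⟩
    have hw' : IsWord n l' := hstep.isWord_iff.1 hw
    have habove : ∀ s, mu.rowLen (r + 1 + 1) + rowCount l' (r + 1 + 1) s ≤
        mu.rowLen (r + 1) + rowCount l' (r + 1) s := by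
      intro s
      interval_cases r
      · have h1 := hra.excess_one_le hl (e := mu.rowLen 1 - mu.rowLen 2) (fun u => by
          have := h.ballot 1 u
          unfold excess
          simp only [Nat.reduceAdd] at this ⊢
          omega) s
        unfold excess at h1
        simp only [Nat.reduceAdd, zero_add] at h1 ⊢
        omega
      · have h1 : rowCount l' 3 s = 0 := by
          refine List.count_eq_zero.2 fun hmem => ?_
          exact absurd (hw'.2 3 (List.mem_of_mem_take hmem)) (lt_irrefl _)
        have h2 := mu.rowLen_anti 2 3 (by omega)
        simp only [Nat.reduceAdd] at h1 h2 ⊢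
        omega
    have h' : IsLattice n l' mu' := by
      refine ⟨hw'.1, fun i s => ?_⟩
      by_cases hi : i = r
      · subst hi
        have h1 := hra.excess_lt s
        rw [hex] at h1
        unfold excess at h1
        omega
      · by_cases hi1 : i = r + 1
        · subst hi1
          have h1 := habove s
          rw [hs.row_ne (r + 1 + 1) (by omega), hs.row_ne (r + 1) (by omega)] at h1
          exact h1
        · have h1 := h.ballot i s
          rw [hs.row_ne i hi] at h1
          rw [hra.rowCount_of_ne hi hi1]
          by_cases hir : i + 1 = r
          · rw [hir] at h1 ⊢
            rw [hra.rowCount_row]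
            split_ifs <;> omega
          · rw [hs.row_ne _ hir] at h1
            rw [hra.rowCount_of_ne hir (by omega)]
            exact h1
    exact ⟨l', h', .inr hstep, slidesTo_of_raiseAt h h' hs hra hex⟩

theorem SlidesTo.slide {n : ℕ} {l l' : List ℕ} {mu mu' : YoungDiagram} {h : IsLattice n l mu}
    {h' : IsLattice n l' mu'} {c : ℕ × ℕ} (hc : IsCorner mu c)
    (hmu : mu'.cells = mu.cells.erase c) (H : SlidesTo n c.1 h h') :
    Slide (tableau h) (tableau h') := by
  obtain ⟨e, h1, h2, h3⟩ := H
  refine ⟨c, e, hc, ?_, h2, hmu, h3⟩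
  rw [← (isShortened_of_erase hc hmu).2] at h1
  exact h1

theorem SlidesTo.eq_tableau {n : ℕ} {l l' : List ℕ} {mu : YoungDiagram} {T : SkewSYT n}
    {h : IsLattice n l mu} {h' : IsLattice n l' T.inner} {c e : ℕ × ℕ} (hc : IsCorner mu c)
    (hmu : T.inner.cells = mu.cells.erase c) (H : SlidesTo n c.1 h h')
    (hT : Relation.ReflTransGen (HoleMove (outerShape h)) (filling l mu, c) (T.entry, e))
    (he : IsCorner (outerShape h) e) : T = tableau h' := by
  obtain ⟨e', h1, h2, h3⟩ := H
  rw [← (isShortened_of_erase hc hmu).2] at h1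
  obtain ⟨h4, -⟩ := holeMoves_unique hT he h1 h2
  exact RowWord.eq_tableau h' rfl fun v hv => by rw [h4, filling_pos hv]

theorem row_lt_two {mu : YoungDiagram} (hmu : mu.rowLen 2 = 0) {c : ℕ × ℕ} (hc : c ∈ mu) :
    c.1 < 2 := by
  by_contra hlt
  have h1 := mu.rowLen_anti 2 c.1 (by omega)
  have h2 : (c.1, c.2) ∈ mu := hc
  rw [YoungDiagram.mem_iff_lt_rowLen] at h2
  omega

/-- Every slide on the tableau of a tame word gives the tableau of the word itself or of the word
after one raising step. -/
theorem exists_of_slide {n : ℕ} {l : List ℕ} {mu : YoungDiagram} (h : IsLattice n l mu)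
    (hw : IsWord n l) (hl : IsTame l) (hmu : mu.rowLen 2 = 0) {T : SkewSYT n}
    (hT : Slide (tableau h) T) :
    ∃ (l' : List ℕ) (h' : IsLattice n l' T.inner), (l = l' ∨ Step l l') ∧
      T.inner.rowLen 2 = 0 ∧ T = tableau h' := by
  obtain ⟨c, e, hc, hmoves, he, hin, -⟩ := hT
  have hc : IsCorner mu c := hc
  obtain ⟨hs, -⟩ := isShortened_of_erase hc hin
  have hc1 : c.1 < 2 := row_lt_two hmu hc.1
  obtain ⟨l', h', hstep, H⟩ := exists_slidesTo h hw hl hs hc1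
  exact ⟨l', h', hstep, by rw [← hs.row_ne 2 (by omega), hmu], H.eq_tableau hc hin hmoves he⟩

theorem exists_of_slides {n : ℕ} {l : List ℕ} {mu : YoungDiagram} (h : IsLattice n l mu)
    (hw : IsWord n l) (hl : IsTame l) (hmu : mu.rowLen 2 = 0) {T : SkewSYT n}
    (hT : Relation.ReflTransGen Slide (tableau h) T) :
    ∃ (l' : List ℕ) (h' : IsLattice n l' T.inner), Relation.ReflTransGen Step l l' ∧
      T.inner.rowLen 2 = 0 ∧ T = tableau h' := by
  induction hT with
  | refl => exact ⟨l, h, .refl, hmu, rfl⟩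
  | @tail T T' _ hs ih =>
    obtain ⟨l₁, h₁, hsteps, hmu₁, hT⟩ := ih
    rw [hT] at hs
    obtain ⟨l', h', hstep, hmu', hT'⟩ := exists_of_slide h₁ ((isWord_iff_of_steps hsteps).1 hw)
      (isTame_of_steps hl hsteps) hmu₁ hs
    refine ⟨l', h', ?_, hmu', hT'⟩
    rcases hstep with rfl | hstep
    · exact hsteps
    · exact hsteps.tail hstep

/-- Slides lead from the tableau of a tame word to one of straight shape. -/
theorem exists_slides {n : ℕ} {l : List ℕ} {mu : YoungDiagram} (h : IsLattice n l mu)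
    (hw : IsWord n l) (hl : IsTame l) (hmu : mu.rowLen 2 = 0) :
    ∃ (l' : List ℕ) (h' : IsLattice n l' ⊥),
      Relation.ReflTransGen Slide (tableau h) (tableau h') := by
  obtain ⟨k, hk⟩ : ∃ k, mu.cells.card = k := ⟨_, rfl⟩
  induction k generalizing l mu with
  | zero =>
    obtain rfl : mu = ⊥ := by
      ext1
      rw [Finset.card_eq_zero.1 hk, YoungDiagram.cells_bot]
    exact ⟨l, h, .refl⟩
  | succ k ih =>
    obtain ⟨c, hc⟩ : ∃ c, IsCorner mu c := by
      obtain ⟨⟨i, j⟩, hmem⟩ := Finset.card_pos.1 (by omega : 0 < mu.cells.card)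
      have h0 : 0 < mu.rowLen 0 := by
        rw [YoungDiagram.mem_cells, YoungDiagram.mem_iff_lt_rowLen] at hmem
        have := mu.rowLen_anti 0 i (by omega)
        omega
      by_cases h1 : mu.rowLen 1 = 0
      · refine ⟨(0, mu.rowLen 0 - 1), ?_, ?_, ?_⟩ <;>
          rw [YoungDiagram.mem_iff_lt_rowLen] <;> simp <;> omega
      · refine ⟨(1, mu.rowLen 1 - 1), ?_, ?_, ?_⟩ <;>
          rw [YoungDiagram.mem_iff_lt_rowLen] <;> simp <;> omega
    have hcells : (eraseCorner hc).cells = mu.cells.erase c := rfl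
    obtain ⟨hs, -⟩ := isShortened_of_erase hc hcells
    have hc1 : c.1 < 2 := row_lt_two hmu hc.1
    obtain ⟨l₁, h₁, hstep, H⟩ := exists_slidesTo h hw hl hs hc1
    have hsteps : Relation.ReflTransGen Step l l₁ := by
      rcases hstep with rfl | hstep
      · exact .refl
      · exact .single hstep
    obtain ⟨l', h', H'⟩ := ih h₁ ((isWord_iff_of_steps hsteps).1 hw) (isTame_of_steps hl hsteps)
      (by rw [← hs.row_ne 2 (by omega), hmu])
      (by rw [hcells, Finset.card_erase_of_mem ((YoungDiagram.mem_cells c).2 hc.1), hk]; rfl)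
    exact ⟨l', h', .head (H.slide hc hcells) H'⟩

end RowWord

/-! ### Row words of Motzkin paths -/

/-- The row of `Γ` in which a step is recorded. -/
def MotzkinStep.row : MotzkinStep → ℕ
  | U => 0
  | D => 1
  | L => 2

namespace MotzkinStep

theorem stepOfRow_row (s : MotzkinStep) : MotzkinPath.stepOfRow s.row = s := by
  cases s <;> rfl

theorem row_stepOfRow {i : ℕ} (h : i < 3) : (MotzkinPath.stepOfRow i).row = i := by
  interval_cases i <;> rfl

theorem row_lt (s : MotzkinStep) : s.row < 3 := by
  cases s <;> simp [row]

theorem row_eq_iff {s : MotzkinStep} {i : ℕ} (h : i < 3) :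
    s.row = i ↔ s = MotzkinPath.stepOfRow i := by
  constructor
  · rintro rfl
    exact (stepOfRow_row s).symm
  · rintro rfl
    exact row_stepOfRow h

end MotzkinStep

namespace RowWord

open MotzkinPath SkewSYT

/-- The row word of the tableau `Γ(M)`. -/
def ofPath {n : ℕ} (M : MotzkinPath n) : List ℕ := M.steps.map MotzkinStep.row

theorem length_ofPath {n : ℕ} (M : MotzkinPath n) : (ofPath M).length = n := by
  rw [ofPath, List.length_map, M.length_eq]

theorem isWord_ofPath {n : ℕ} (M : MotzkinPath n) : IsWord n (ofPath M) := by
  refine ⟨length_ofPath M, fun x hx => ?_⟩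
  obtain ⟨s, -, rfl⟩ := List.mem_map.1 hx
  exact s.row_lt

theorem getElem?_ofPath {n : ℕ} (M : MotzkinPath n) {i : ℕ} (h : i < 3) (v : ℕ) :
    (ofPath M)[v]? = some i ↔ M.steps[v]? = some (stepOfRow i) := by
  rw [ofPath, List.getElem?_map]
  rcases M.steps[v]? with _ | s
  · simp
  · simp [MotzkinStep.row_eq_iff h]

theorem rowCount_map (l : List MotzkinStep) {i : ℕ} (h : i < 3) (t : ℕ) :
    rowCount (l.map MotzkinStep.row) i t = (l.take t).count (stepOfRow i) := by
  rw [rowCount, ← List.map_take, List.count_eq_countP, List.countP_map, List.count_eq_countP]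
  congr 1
  funext s
  simp [MotzkinStep.row_eq_iff h]

theorem excess_map (l : List MotzkinStep) (t : ℕ) :
    excess (l.map MotzkinStep.row) 0 t = -((l.take t).map MotzkinStep.rise).sum := by
  rw [excess, rowCount_map l (by omega), rowCount_map l (by omega), sum_rise]
  simp only [stepOfRow]
  omega

theorem isMotzkin_ofPath {n : ℕ} (M : MotzkinPath n) : IsMotzkin (ofPath M) := by
  refine ⟨fun s => ?_, ?_⟩
  · have := M.height_nonneg s
    rw [ofPath, excess_map]
    omega
  · have := M.height_end
    rw [length_ofPath, ofPath, excess_map, List.take_of_length_le M.length_eq.le]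
    omega

theorem ofPath_injective (n : ℕ) : Function.Injective (ofPath (n := n)) := by
  intro M M' h
  refine MotzkinPath.ext (List.map_injective_iff.2 ?_ h)
  exact Function.LeftInverse.injective MotzkinStep.stepOfRow_row

theorem exists_ofPath_eq {n : ℕ} {l : List ℕ} (hw : IsWord n l) (hl : IsMotzkin l) :
    ∃ M : MotzkinPath n, ofPath M = l := by
  have hmap : (l.map stepOfRow).map MotzkinStep.row = l := by
    rw [List.map_map]
    refine (List.map_congr_left fun x hx => ?_).trans (List.map_id l)
    exact MotzkinStep.row_stepOfRow (hw.2 x hx)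
  refine ⟨⟨l.map stepOfRow, by rw [List.length_map, hw.1], fun i => ?_, ?_⟩, hmap⟩
  · have h1 := excess_map (l.map stepOfRow) i
    have h2 := hl.1 i
    rw [hmap] at h1
    omega
  · have h1 := excess_map (l.map stepOfRow) l.length
    rw [hmap, hl.2, List.take_of_length_le (by simp)] at h1
    omega

theorem descents_ofPath {n : ℕ} (M : MotzkinPath n) : descents (ofPath M) = M.descents := by
  ext i
  refine and_congr_right fun _ => ?_
  rw [ofPath, List.getElem?_map, List.getElem?_map]
  rcases M.steps[i - 1]? with _ | a <;> rcases M.steps[i]? with _ | b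
  · simp
  · simp
  · simp
  · cases a <;> cases b <;> simp [MotzkinStep.row]

theorem rowLen_gammaInner {n : ℕ} (M : MotzkinPath n) (i : ℕ) :
    M.gammaInner.rowLen i = if i < 2 then n - 2 * M.numU else 0 := by
  have h : ∀ j, j < M.gammaInner.rowLen i ↔ i < 2 ∧ j < n - 2 * M.numU := fun j => by
    rw [← YoungDiagram.mem_iff_lt_rowLen, mem_gammaInner]
  have h1 := h (M.gammaInner.rowLen i)
  have h2 := h (n - 2 * M.numU)
  split_ifs <;> have h3 := h 0 <;> omega

theorem isLattice_ofPath {n : ℕ} (M : MotzkinPath n) : IsLattice n (ofPath M) M.gammaInner := by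
  refine ⟨length_ofPath M, fun i t => ?_⟩
  rw [rowLen_gammaInner, rowLen_gammaInner]
  match i with
  | 0 =>
    have := (isMotzkin_ofPath M).1 t
    unfold excess at this
    simp at this ⊢
    omega
  | 1 =>
    have h1 : rowCount (ofPath M) 2 t ≤ n - 2 * M.numU := by
      rw [ofPath, rowCount_map _ (by omega)]
      have h2 := M.count_L
      have h3 := (List.take_sublist t M.steps).count_le MotzkinStep.L
      simp only [stepOfRow]
      omega
    simp
    omega
  | i + 2 =>
    have h1 : rowCount (ofPath M) (i + 2 + 1) t = 0 := by
      refine List.count_eq_zero.2 fun hmem => ?_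
      have := (isWord_ofPath M).2 _ (List.mem_of_mem_take hmem)
      omega
    rw [h1]
    simp

theorem gamma_eq_tableau {n : ℕ} (M : MotzkinPath n) : M.gamma = tableau (isLattice_ofPath M) := by
  refine eq_tableau _ rfl fun v hv => ?_
  obtain ⟨i, hx⟩ := exists_getElem? hv
  have hi : i < 3 := (isWord_ofPath M).2 i (List.mem_of_getElem? hx)
  have hs : M.IsStep (stepOfRow i) v := (getElem?_ofPath M hi v).1 hx
  have hc : rowCount (ofPath M) i v = Nat.count (M.IsStep (stepOfRow i)) v := by
    rw [ofPath, rowCount_map _ hi, count_take]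
  have hmem : pos (ofPath M) M.gammaInner v ∈ M.gammaOuter.cells \ M.gammaInner.cells := by
    rw [pos_eq hx, mem_gammaCells, rowLen_gammaInner, hc, Nat.add_sub_cancel_left]
    exact ⟨hi, Nat.le_add_right _ _,
      Nat.count_strict_mono hs (by rw [length_ofPath] at hv; exact hv)⟩
  change M.gammaEntry _ = _
  rw [gammaEntry, if_pos hmem, pos_eq hx]
  simp only
  rw [rowLen_gammaInner, Nat.add_sub_cancel_left, hc, Nat.nth_count hs]

/-! ### Rectification -/

theorem isDominant_of_isLattice {n : ℕ} {l : List ℕ} (h : IsLattice n l ⊥) : IsDominant l := by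
  intro s
  have h0 := h.ballot 0 s
  have h1 := h.ballot 1 s
  simp only [rowLen_bot, zero_add, Nat.reduceAdd] at h0 h1
  unfold excess
  simp only [zero_add, Nat.reduceAdd]
  omega

theorem isLattice_of_isDominant {n : ℕ} {l : List ℕ} (hw : IsWord n l) (hl : IsDominant l) :
    IsLattice n l ⊥ := by
  refine ⟨hw.1, fun i t => ?_⟩
  simp only [rowLen_bot, zero_add]
  obtain ⟨h0, h1⟩ := hl t
  unfold excess at h0 h1
  simp only [zero_add, Nat.reduceAdd] at h0 h1
  match i with
  | 0 => simp only [zero_add]; omega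
  | 1 => simp only [Nat.reduceAdd]; omega
  | i + 2 =>
    have h2 : rowCount l (i + 2 + 1) t = 0 := by
      refine List.count_eq_zero.2 fun hmem => ?_
      have := hw.2 _ (List.mem_of_mem_take hmem)
      omega
    omega

theorem colLen_outerShape_le {n : ℕ} {l : List ℕ} (hw : IsWord n l) (h : IsLattice n l ⊥) :
    (outerShape h).colLen 0 ≤ 3 := by
  by_contra hlt
  have h1 : (3, 0) ∈ outerShape h := YoungDiagram.mem_iff_lt_colLen.2 (by omega)
  rw [mem_outerShape, rowLen_bot, zero_add] at h1
  exact absurd (hw.2 3 (List.mem_of_mem_take (List.count_pos_iff.1 h1))) (lt_irrefl _)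

/-- The rectifications of `Γ(M)` are the tableaux of the dominant words that are reached from the
row word of `M`. -/
theorem isRectification_gamma_iff {n : ℕ} (M : MotzkinPath n) {v : List ℕ} (h : IsLattice n v ⊥)
    (hv : Relation.ReflTransGen Step (ofPath M) v) (S : SkewSYT n) :
    IsRectification M.gamma S ↔ S = tableau h := by
  have hw := isWord_ofPath M
  have hl := (isMotzkin_ofPath M).isTame
  have hmu : M.gammaInner.rowLen 2 = 0 := by simp [rowLen_gammaInner]
  have key : ∀ S, IsRectification M.gamma S → S = tableau h := by
    rintro S ⟨hS, hS'⟩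
    rw [gamma_eq_tableau] at hS
    obtain ⟨l', h', hsteps, -, hS⟩ := exists_of_slides _ hw hl hmu hS
    have hin : S.inner = ⊥ := hS'
    have h₀ : IsLattice n l' ⊥ := hin ▸ h'
    obtain rfl := (isDominant_of_isLattice h₀).unique (isDominant_of_isLattice h) hsteps hv
    rw [hS]
    congr 1
  refine ⟨key S, ?_⟩
  rintro rfl
  obtain ⟨l', h', hslides⟩ := exists_slides (isLattice_ofPath M) hw hl hmu
  rw [← gamma_eq_tableau] at hslides
  have h1 : IsRectification M.gamma (tableau h') := ⟨hslides, rfl⟩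
  rw [← key _ h1]
  exact h1

end RowWord

open RowWord in
/-- For every `n`, jeu de taquin rectification after `Γ` is a well-defined bijection from the
Motzkin paths of length `n` onto the standard Young tableaux of straight shape, of size `n`, with
at most three rows, and it preserves descent sets. -/
theorem mainTheorem8 (n : ℕ) :
    ∃ gammaTilde : MotzkinPath n → StraightSYT n 3,
      (∀ (M : MotzkinPath n) (S : SkewSYT n),
        SkewSYT.IsRectification M.gamma S ↔ S = (gammaTilde M).1) ∧
      Function.Bijective gammaTilde ∧
      ∀ M : MotzkinPath n, M.descents = (gammaTilde M).1.descents := by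
  choose v hv hdom using fun M : MotzkinPath n => (isMotzkin_ofPath M).exists_dominant
  have hw : ∀ M, IsWord n (v M) := fun M => (isWord_iff_of_steps (hv M)).1 (isWord_ofPath M)
  have hlat : ∀ M, IsLattice n (v M) ⊥ := fun M => isLattice_of_isDominant (hw M) (hdom M)
  refine ⟨fun M => ⟨tableau (hlat M), rfl, colLen_outerShape_le (hw M) (hlat M)⟩,
    fun M S => isRectification_gamma_iff M (hlat M) (hv M) S, ⟨fun M M' h => ?_, fun T => ?_⟩,
    fun M => ?_⟩
  · have heq : v M = v M' := word_eq_of_tableau_eq (congrArg Subtype.val h)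
    exact ofPath_injective n ((isMotzkin_ofPath M).injective (isMotzkin_ofPath M') (hdom M) (hv M)
      (heq ▸ hv M'))
  · obtain ⟨T, hT, hr⟩ := T
    obtain ⟨l, h, hlw, rfl⟩ := exists_word_of_isStraight T hT hr
    have hl := isDominant_of_isLattice h
    obtain ⟨m, hm, hml⟩ := hl.exists_isMotzkin
    obtain ⟨M, rfl⟩ := exists_ofPath_eq ((isWord_iff_of_steps hml).2 hlw) hm
    obtain rfl := (hdom M).unique hl (hv M) hml
    exact ⟨M, rfl⟩
  · rw [descents_tableau, descents_eq_of_steps (hv M), descents_ofPath]
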